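/- Let $\operatorname{Sim}^0(n)$ be the group of all transformations $x\mapsto a f(x)+v$ of the Euclidean space $\mathbb{R}^n$ with $a\in\mathbb{R}^+=(0,\infty)$, $f\in\operatorname{SO}(n)$, $v\in\mathbb{R}^n$. Identify $\mathbb{R}^+$, $\operatorname{SO}(n)$ and $\mathbb{R}^n$ with its subgroups of homotheties $x\mapsto ax$, of rotations about the origin, and of translations. For a subspace $W\subset\mathbb{R}^n$ regard $\operatorname{SO}(W)$ as the subgroup of $\operatorname{SO}(n)$ of the elements that are the identity on $W^\perp$. A connected Lie subgroup (not necessarily closed) is a subgroup generated by the exponentials of the elements of a Lie subalgebra. All products below are internal products of subgroups of $\operatorname{Sim}^0(n)$: $\times$ is direct (so the factors commute), and $\ltimes$ is semidirect with the second factor normal. **Theorem.** Let $G\subset\operatorname{Sim}^0(n)$ be a connected Lie subgroup. Then $G$ acts transitively on $\mathbb{R}^n$ if and only if $G$ is conjugate in $\operatorname{Sim}^0(n)$ to a group of one of the following types. * **Type 1:** $(\mathbb{R}^+\times H)\ltimes\mathbb{R}^n$, where $H\subset\operatorname{SO}(n)$ is a connected Lie subgroup. * **Type 2:** $H\ltimes\mathbb{R}^n$,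 where $H\subset\operatorname{SO}(n)$ is a connected Lie subgroup. * **Type 3:** $(\mathbb{R}^\Phi\times H)\ltimes\mathbb{R}^n$, where $H\subset\operatorname{SO}(n)$ is a connected Lie subgroup, $\Phi\colon\mathbb{R}^+\to\operatorname{SO}(n)$ is a continuous homomorphism, and $\mathbb{R}^\Phi=\{a\cdot\Phi(a)\mid a\in\mathbb{R}^+\}$ is the group of screw homotheties $x\mapsto a\,\Phi(a)x$. * **Type 4:** $(H\times U^\Psi)\ltimes W$, where $\mathbb{R}^n=U\oplus W$ is an orthogonal decomposition, $H\subset\operatorname{SO}(W)$ is a connected Lie subgroup, $\Psi\colon U\to\operatorname{SO}(W)$ is a continuous homomorphism with injective differential $d\Psi\colon U\to\mathfrak{so}(W)$ (equivalently, with discrete kernel), and $U^\Psi=\{\Psi(u)\cdot u\mid u\in U\}$ is the group of screw isometries $x\mapsto\Psi(u)x+u$. -/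

import Mathlib

/-- Euclidean space `ℝⁿ`. -/
abbrev Euc (n : ℕ) : Type := EuclideanSpace ℝ (Fin n)

/-- The orthogonal group `O(n)`, as the group of linear isometries of `ℝⁿ`. -/
abbrev OrthGroup (n : ℕ) : Type := Euc n ≃ₗᵢ[ℝ] Euc n

/-- The group of invertible affine transformations of `ℝⁿ`. -/
abbrev AffGroup (n : ℕ) : Type := Euc n ≃ᵃ[ℝ] Euc n

/-- The multiplicative group `ℝ⁺` of positive reals. -/
abbrev PosReal : Type := {a : ℝ // 0 < a}

/-- The special orthogonal group `SO(n)`. -/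
def SOGroup (n : ℕ) : Subgroup (OrthGroup n) where
  carrier := {f | LinearMap.det (f.toLinearEquiv : Euc n →ₗ[ℝ] Euc n) = 1}
  one_mem' := by
    change LinearMap.det (LinearMap.id : Euc n →ₗ[ℝ] Euc n) = 1
    exact LinearMap.det_id
  mul_mem' := by
    intro f g hf hg
    change LinearMap.det ((f.toLinearEquiv : Euc n →ₗ[ℝ] Euc n) *
      (g.toLinearEquiv : Euc n →ₗ[ℝ] Euc n)) = 1
    rw [map_mul, hf, hg, one_mul]
  inv_mem' := by
    intro f hf
    have h := LinearEquiv.det_symm_mul_det f.toLinearEquiv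
    have hf' : LinearMap.det (f.toLinearEquiv : Euc n →ₗ[ℝ] Euc n) = 1 := hf
    rw [hf', mul_one] at h
    exact h

/-- `SO(W)` for a subspace `W ⊆ ℝⁿ`, regarded as a subgroup of `SO(n)` in the usual way: its
elements act as the identity on the orthogonal complement of `W`. -/
def SOSub {n : ℕ} (W : Submodule ℝ (Euc n)) : Subgroup (OrthGroup n) where
  carrier := {f | f ∈ SOGroup n ∧ ∀ x ∈ Wᗮ, f x = x}
  one_mem' := ⟨one_mem _, fun _ _ => rfl⟩
  mul_mem' := by
    rintro f g ⟨hf, hf'⟩ ⟨hg, hg'⟩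
    refine ⟨mul_mem hf hg, fun x hx => ?_⟩
    change f (g x) = x
    rw [hg' x hx, hf' x hx]
  inv_mem' := by
    rintro f ⟨hf, hf'⟩
    refine ⟨inv_mem hf, fun x hx => ?_⟩
    change f.symm x = x
    rw [LinearIsometryEquiv.symm_apply_eq, hf' x hx]

/-- `Sim⁰(n)`: the transformations `x ↦ a f(x) + v` with `a > 0`, `f ∈ SO(n)`, `v ∈ ℝⁿ`. -/
def Sim0 (n : ℕ) : Subgroup (AffGroup n) where
  carrier := {g | ∃ a : PosReal, ∃ f ∈ SOGroup n, ∃ v : Euc n, ∀ x, g x = (a : ℝ) • f x + v}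
  one_mem' := ⟨1, 1, one_mem _, 0, fun x => by simp⟩
  mul_mem' := by
    rintro g g' ⟨a, f, hf, v, hg⟩ ⟨a', f', hf', v', hg'⟩
    refine ⟨a * a', f * f', mul_mem hf hf', (a : ℝ) • f v' + v, fun x => ?_⟩
    simp [AffineEquiv.mul_def, hg, hg', mul_smul, add_assoc]
  inv_mem' := by
    rintro g ⟨a, f, hf, v, hg⟩
    refine ⟨a⁻¹, f⁻¹, inv_mem hf, -(((a : ℝ)⁻¹) • f⁻¹ v), fun x => ?_⟩
    have ha : (a : ℝ) ≠ 0 := a.2.ne'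
    change g.symm x = _
    rw [AffineEquiv.symm_apply_eq, hg]
    change x = (a : ℝ) • f (((a⁻¹ : PosReal) : ℝ) • f.symm x + -((a : ℝ)⁻¹ • f.symm v)) + v
    simp [ha]

/-! ### Connected Lie subgroups -/

/-- Let `ρ` be a (faithful) representation of a group `Γ` by elements of a Banach algebra.
A subgroup `G` of `Γ` is a connected Lie subgroup (not necessarily closed) if it is generated by
the exponentials of the elements of some Lie subalgebra `𝔤`, i.e. of a linear subspace that is
closed under commutators. -/
def IsConnectedLieSubgroup {Γ A : Type*} [Group Γ] [NormedRing A] [NormedAlgebra ℝ A]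
    (ρ : Γ →* A) (G : Subgroup Γ) : Prop :=
  ∃ 𝔤 : Submodule ℝ A,
    (∀ X ∈ 𝔤, ∀ Y ∈ 𝔤, X * Y - Y * X ∈ 𝔤) ∧
    (∀ X ∈ 𝔤, ∃ g : Γ, ρ g = NormedSpace.exp X) ∧
    G = Subgroup.closure {g : Γ | ∃ X ∈ 𝔤, ρ g = NormedSpace.exp X}

/-- The standard representation of `O(n)` on `ℝⁿ`. -/
noncomputable def linRep (n : ℕ) : OrthGroup n →* (Euc n →L[ℝ] Euc n) where
  toFun f := (f.toContinuousLinearEquiv : Euc n →L[ℝ] Euc n)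
  map_one' := rfl
  map_mul' _ _ := rfl

/-- The standard linear representation of the affine group of `ℝⁿ` on `ℝⁿ × ℝ`: the
transformation `x ↦ L x + v` goes to `(x, t) ↦ (L x + t v, t)`. -/
noncomputable def affRep (n : ℕ) : AffGroup n →* (Euc n × ℝ →L[ℝ] Euc n × ℝ) where
  toFun g := LinearMap.toContinuousLinearMap
    (((g.linear : Euc n →ₗ[ℝ] Euc n).comp (LinearMap.fst ℝ (Euc n) ℝ) +
      (LinearMap.snd ℝ (Euc n) ℝ).smulRight (g 0)).prod (LinearMap.snd ℝ (Euc n) ℝ))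
  map_one' := by
    refine ContinuousLinearMap.ext fun p => Prod.ext ?_ rfl
    change p.1 + p.2 • (0 : Euc n) = p.1
    simp
  map_mul' g h := by
    have key : g (h 0) = g.linear (h 0) + g 0 := by
      have := g.map_vadd 0 (h 0)
      simpa using this
    have hl : ∀ y, (g * h).linear y = g.linear (h.linear y) := fun _ => rfl
    have h0 : (g * h) 0 = g (h 0) := rfl
    refine ContinuousLinearMap.ext fun p => Prod.ext ?_ rfl
    change (g * h).linear p.1 + p.2 • (g * h) 0 =
      g.linear (h.linear p.1 + p.2 • h 0) + p.2 • g 0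
    rw [hl, h0, key]
    simp [add_assoc]

/-! ### Products of subgroups -/

/-- `K = A × B` as an internal direct product. -/
def IsDirectProd {Γ : Type*} [Group Γ] (A B K : Subgroup Γ) : Prop :=
  (∀ a ∈ A, ∀ b ∈ B, a * b = b * a) ∧ Disjoint A B ∧ K = A ⊔ B

/-- `K = A ⋉ N` as an internal semidirect product, with `N` normal in `K`. -/
def IsSemidirectProd {Γ : Type*} [Group Γ] (A N K : Subgroup Γ) : Prop :=
  (∀ a ∈ A, ∀ x ∈ N, a * x * a⁻¹ ∈ N) ∧ Disjoint A N ∧ K = A ⊔ N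

/-! ### The building blocks -/

/-- Orthogonal transformations regarded as affine transformations. -/
noncomputable def rotHom (n : ℕ) : OrthGroup n →* AffGroup n where
  toFun f := f.toLinearEquiv.toAffineEquiv
  map_one' := rfl
  map_mul' _ _ := rfl

/-- The group of translations by the vectors of a subspace `V`. -/
def translations {n : ℕ} (V : Submodule ℝ (Euc n)) : Subgroup (AffGroup n) where
  carrier := {g | ∃ v ∈ V, ∀ x, g x = x + v}
  one_mem' := ⟨0, V.zero_mem, fun x => by simp⟩
  mul_mem' := by
    rintro g h ⟨v, hv, hg⟩ ⟨w, hw, hh⟩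
    refine ⟨w + v, V.add_mem hw hv, fun x => ?_⟩
    change g (h x) = _
    rw [hg, hh, add_assoc]
  inv_mem' := by
    rintro g ⟨v, hv, hg⟩
    refine ⟨-v, V.neg_mem hv, fun x => ?_⟩
    change g.symm x = _
    rw [AffineEquiv.symm_apply_eq, hg]
    simp

/-- The group `ℝ^Φ = {a · Φ(a) | a ∈ ℝ⁺}` of screw homotheties. -/
def screwHomotheties {n : ℕ} (Φ : PosReal →* SOGroup n) : Subgroup (AffGroup n) where
  carrier := {g | ∃ a : PosReal, ∀ x, g x = (a : ℝ) • (Φ a : OrthGroup n) x}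
  one_mem' := ⟨1, fun x => by simp⟩
  mul_mem' := by
    rintro g h ⟨a, hg⟩ ⟨b, hh⟩
    refine ⟨a * b, fun x => ?_⟩
    change g (h x) = _
    rw [hg, hh]
    simp [mul_smul]
  inv_mem' := by
    rintro g ⟨a, hg⟩
    refine ⟨a⁻¹, fun x => ?_⟩
    have ha : (a : ℝ) ≠ 0 := a.2.ne'
    change g.symm x = _
    rw [AffineEquiv.symm_apply_eq, hg, map_inv]
    change x = (a : ℝ) • (Φ a : OrthGroup n)
      (((a⁻¹ : PosReal) : ℝ) • (Φ a : OrthGroup n).symm x)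
    simp [ha]

/-- The group `ℝ⁺` of homotheties `x ↦ a x`, `a > 0`. -/
noncomputable def homotheties (n : ℕ) : Subgroup (AffGroup n) := screwHomotheties 1

/-- For the orthogonal decomposition `ℝⁿ = U ⊕ W`, `U = Wᗮ`, and a homomorphism
`Ψ : U → SO(W)`, the group `U^Ψ = {Ψ(u) · u | u ∈ U}` of screw isometries. -/
noncomputable def screwIsometries {n : ℕ} (W : Submodule ℝ (Euc n))
    (Ψ : Multiplicative Wᗮ →* SOSub W) : Subgroup (AffGroup n) where
  carrier := {g | ∃ u : Wᗮ, ∀ x,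
    g x = (Ψ (Multiplicative.ofAdd u) : OrthGroup n) x + (u : Euc n)}
  one_mem' := ⟨0, fun x => by simp⟩
  mul_mem' := by
    rintro g h ⟨u, hg⟩ ⟨v, hh⟩
    refine ⟨u + v, fun x => ?_⟩
    change g (h x) = _
    rw [hg, hh, map_add, (Ψ (Multiplicative.ofAdd u)).2.2 v v.2, ofAdd_add, map_mul]
    change _ = (Ψ (Multiplicative.ofAdd u) : OrthGroup n)
      ((Ψ (Multiplicative.ofAdd v) : OrthGroup n) x) + ((u : Euc n) + (v : Euc n))
    abel
  inv_mem' := by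
    rintro g ⟨u, hg⟩
    refine ⟨-u, fun x => ?_⟩
    change g.symm x = _
    rw [AffineEquiv.symm_apply_eq, hg, map_add,
      (Ψ (Multiplicative.ofAdd u)).2.2 _ (-u).2, ofAdd_neg, map_inv]
    change x = (Ψ (Multiplicative.ofAdd u) : OrthGroup n)
      ((Ψ (Multiplicative.ofAdd u) : OrthGroup n).symm x) + ((-u : Wᗮ) : Euc n) + (u : Euc n)
    simp

/-! ### The four types -/

/-- `K = (ℝ⁺ × H) ⋉ ℝⁿ`, with `H ⊆ SO(n)` a connected Lie subgroup. -/
def IsType1 {n : ℕ} (K : Subgroup (AffGroup n)) : Prop :=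
  ∃ H : Subgroup (OrthGroup n), H ≤ SOGroup n ∧ IsConnectedLieSubgroup (linRep n) H ∧
    ∃ D : Subgroup (AffGroup n),
      IsDirectProd (homotheties n) (H.map (rotHom n)) D ∧
      IsSemidirectProd D (translations ⊤) K

/-- `K = H ⋉ ℝⁿ`, with `H ⊆ SO(n)` a connected Lie subgroup. -/
def IsType2 {n : ℕ} (K : Subgroup (AffGroup n)) : Prop :=
  ∃ H : Subgroup (OrthGroup n), H ≤ SOGroup n ∧ IsConnectedLieSubgroup (linRep n) H ∧
    IsSemidirectProd (H.map (rotHom n)) (translations ⊤) K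

/-- `K = (ℝ^Φ × H) ⋉ ℝⁿ`, with `H ⊆ SO(n)` a connected Lie subgroup and `Φ : ℝ⁺ → SO(n)` a
(continuous) homomorphism. -/
def IsType3 {n : ℕ} (K : Subgroup (AffGroup n)) : Prop :=
  ∃ H : Subgroup (OrthGroup n), H ≤ SOGroup n ∧ IsConnectedLieSubgroup (linRep n) H ∧
    ∃ Φ : PosReal →* SOGroup n, Continuous (fun a => linRep n (Φ a)) ∧
      ∃ D : Subgroup (AffGroup n),
        IsDirectProd (screwHomotheties Φ) (H.map (rotHom n)) D ∧
        IsSemidirectProd D (translations ⊤) K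

/-- `K = (H × U^Ψ) ⋉ W`, with `ℝⁿ = U ⊕ W` an orthogonal decomposition (so `U = Wᗮ`),
`H ⊆ SO(W)` a connected Lie subgroup and `Ψ : U → SO(W)` a (continuous) homomorphism with
injective differential `dΨ : U → 𝔰𝔬(W)`. -/
def IsType4 {n : ℕ} (K : Subgroup (AffGroup n)) : Prop :=
  ∃ W : Submodule ℝ (Euc n),
    ∃ H : Subgroup (OrthGroup n), H ≤ SOSub W ∧ IsConnectedLieSubgroup (linRep n) H ∧
      ∃ Ψ : Multiplicative Wᗮ →* SOSub W,
        Continuous (fun u : Wᗮ => linRep n (Ψ (Multiplicative.ofAdd u))) ∧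
        (∃ dΨ : Wᗮ →L[ℝ] (Euc n →L[ℝ] Euc n),
          HasFDerivAt (fun u : Wᗮ => linRep n (Ψ (Multiplicative.ofAdd u))) dΨ 0 ∧
          Function.Injective dΨ) ∧
        ∃ D : Subgroup (AffGroup n),
          IsDirectProd (H.map (rotHom n)) (screwIsometries W Ψ) D ∧
          IsSemidirectProd D (translations W) K

/-!
The Lie algebra `𝔰` of `G` consists of affine fields `x ↦ B x + b` with `B ∈ ℝ ⊕ 𝔰𝔬(n)`. If `G` is
transitive, then no proper affine subspace is tangent to all these fields. The linear parts of the
fields act by skew commutators for the Hilbert–Schmidt product, so that an ideal containing all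
brackets has a central complement.

If some linear part is not skew, this complement contains an operator `1 + A` with `A` skew. Being
invertible and central, its field has a zero, at which the value of every field in `𝔰` is a
translation in `𝔰`. All fields are thus tangent to the orbit of that point under these translations,
so `𝔰` contains all translations, and `G` is of type 3.

If all linear parts are skew, let `W` be the space of the translations in `𝔰`. The fields in `𝔰`
with `b ∈ Wᗮ` form a Lie algebra on which `B ↦ b` is a cocycle. Projecting it orthogonally to the
coboundaries determines an origin for which `B b' = 0` for all such fields. Then every `b ∈ Wᗮ`
occurs, so that the operators `B` vanish on `Wᗮ`, and a central complement of the fields with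
`b = 0` is the graph of the differential of `Ψ`. Hence a conjugate of `G` is of type 4.

Conversely, groups of types 1, 2 and 3 contain all translations, while in a group of type 4 the
screw isometries in `U^Ψ` and the translations in `W` together move any point to any other.
-/

open scoped Nat InnerProductSpace
open NormedSpace (exp)

/-! ### Exponentials of operators -/

section Exponential

variable {A : Type*} [NormedRing A] [NormedAlgebra ℝ A] [CompleteSpace A]

theorem exp_add_of_commute_real {X Y : A} (h : Commute X Y) : exp (X + Y) = exp X * exp Y := by
  let _ := NormedAlgebra.restrictScalars ℚ ℝ A
  exact NormedSpace.exp_add_of_commute h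

theorem exp_neg_mul_exp (X : A) : exp (-X) * exp X = 1 := by
  rw [← exp_add_of_commute_real (Commute.neg_left rfl), neg_add_cancel, NormedSpace.exp_zero]

theorem exp_conj_of_mul_eq_one {P Q : A} (hPQ : P * Q = 1) (hQP : Q * P = 1) (X : A) :
    exp (P * X * Q) = P * exp X * Q := by
  let _ := NormedAlgebra.restrictScalars ℚ ℝ A
  exact NormedSpace.exp_units_conj ⟨P, Q, hPQ, hQP⟩ X

theorem exp_add_smul (s t : ℝ) (X : A) : exp ((s + t) • X) = exp (s • X) * exp (t • X) := by
  rw [add_smul, exp_add_of_commute_real (((Commute.refl X).smul_left s).smul_right t)]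

theorem exp_smul_one_add (t : ℝ) (X : A) :
    exp (t • (1 + X)) = Real.exp t • exp (t • X) := by
  rw [smul_add, exp_add_of_commute_real ((Commute.one_left _).smul_left t),
    ← Algebra.algebraMap_eq_smul_one, ← NormedSpace.algebraMap_exp_comm, ← Real.exp_eq_exp_ℝ,
    Algebra.algebraMap_eq_smul_one, smul_mul_assoc, one_mul]

theorem continuous_exp_real : Continuous (exp : A → A) := by
  let _ := NormedAlgebra.restrictScalars ℚ ℝ A
  exact NormedSpace.exp_continuous

end Exponential

section OperatorExponential

variable {F F' : Type*} [NormedAddCommGroup F] [NormedSpace ℝ F] [CompleteSpace F]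
  [NormedAddCommGroup F'] [NormedSpace ℝ F'] [CompleteSpace F']

theorem hasSum_exp_apply (X : F →L[ℝ] F) (x : F) :
    HasSum (fun k : ℕ => (k !⁻¹ : ℝ) • (X ^ k) x) (exp X x) :=
  (NormedSpace.exp_series_hasSum_exp' (𝕂 := ℝ) X).mapL (ContinuousLinearMap.apply ℝ F x)

theorem exp_apply_mem {M : Submodule ℝ F} (hM : IsClosed (M : Set F)) {X : F →L[ℝ] F}
    (hX : ∀ x ∈ M, X x ∈ M) {x : F} (hx : x ∈ M) : exp X x ∈ M := by
  have hpow (k : ℕ) : (X ^ k) x ∈ M := by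
    induction k with
    | zero => exact hx
    | succ k ih => rw [pow_succ']; exact hX _ ih
  exact hM.mem_of_tendsto (hasSum_exp_apply X x)
    (.of_forall fun s => M.sum_mem fun k _ => M.smul_mem _ (hpow k))

theorem exp_apply_of_intertwines (T : F →L[ℝ] F') {X : F →L[ℝ] F} {Y : F' →L[ℝ] F'}
    (h : ∀ x, Y (T x) = T (X x)) (x : F) : exp Y (T x) = T (exp X x) := by
  have hpow (k : ℕ) : (Y ^ k) (T x) = T ((X ^ k) x) := by
    induction k with
    | zero => rfl
    | succ k ih =>
      rw [pow_succ', pow_succ']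
      exact (congrArg Y ih).trans (h _)
  refine (hasSum_exp_apply Y (T x)).unique ?_
  simpa [hpow] using (hasSum_exp_apply X x).mapL T

theorem exp_sub_exp_apply_mem {M : Submodule ℝ F} (hM : IsClosed (M : Set F)) {X Y : F →L[ℝ] F}
    (hX : ∀ x ∈ M, X x ∈ M) (hXY : ∀ x, X x - Y x ∈ M) (x : F) : exp X x - exp Y x ∈ M := by
  -- `X × Y` preserves the closed subspace `{(x, y) | x - y ∈ M}` of `F × F`.
  let D : F × F →L[ℝ] F := .fst ℝ F F - .snd ℝ F F
  have hinv (z : F × F) (hz : z.1 - z.2 ∈ M) : X z.1 - Y z.2 ∈ M := by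
    have : X z.1 - Y z.2 = X (z.1 - z.2) + (X z.2 - Y z.2) := by rw [map_sub]; abel
    rw [this]
    exact M.add_mem (hX _ hz) (hXY _)
  have hmem : D (exp (X.prodMap Y) (x, x)) ∈ M :=
    exp_apply_mem (M := M.comap (D : F × F →ₗ[ℝ] F)) (X := X.prodMap Y)
      (hM.preimage D.continuous) hinv (show x - x ∈ M by simp)
  have hfst : exp X x = (exp (X.prodMap Y) (x, x)).1 :=
    exp_apply_of_intertwines (.fst ℝ F F) (X := X.prodMap Y) (fun _ => rfl) (x, x)
  have hsnd : exp Y x = (exp (X.prodMap Y) (x, x)).2 :=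
    exp_apply_of_intertwines (.snd ℝ F F) (X := X.prodMap Y) (fun _ => rfl) (x, x)
  rwa [hfst, hsnd]

theorem exp_apply_of_apply_apply_eq_zero {X : F →L[ℝ] F} {x : F} (h : X (X x) = 0) :
    exp X x = x + X x := by
  have hzero : ∀ k ∉ Finset.range 2, (k !⁻¹ : ℝ) • (X ^ k) x = 0 := by
    intro k hk
    obtain ⟨m, rfl⟩ := Nat.exists_eq_add_of_le' (not_lt.1 (Finset.mem_range.not.1 hk))
    have hpow : (X ^ (m + 2)) x = (X ^ m) (X (X x)) := by rw [pow_add, pow_two]; rfl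
    rw [hpow, h, map_zero, smul_zero]
  refine (hasSum_exp_apply X x).unique ?_
  simpa [Finset.sum_range_succ] using hasSum_sum_of_ne_finset_zero hzero

theorem exp_apply_of_apply_eq_zero {X : F →L[ℝ] F} {x : F} (h : X x = 0) : exp X x = x := by
  rw [exp_apply_of_apply_apply_eq_zero (by rw [h, map_zero]), h, add_zero]

end OperatorExponential

/-! ### Subgroups generated by exponentials -/

section ExpSubgroup

variable {Γ A : Type*} [Group Γ] [NormedRing A] [NormedAlgebra ℝ A]

/-- The subgroup of `Γ` generated by the elements that a representation `ρ : Γ →* A` maps to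
exponentials of elements of the subspace `𝔤` of `A`. The connected Lie subgroups of `Γ` are those
for which `𝔤` is a Lie algebra all of whose exponentials come from `Γ`. -/
def expSubgroup (ρ : Γ →* A) (𝔤 : Submodule ℝ A) : Subgroup Γ :=
  Subgroup.closure {g | ∃ X ∈ 𝔤, ρ g = exp X}

theorem mem_expSubgroup_of_eq_exp {ρ : Γ →* A} {𝔤 : Submodule ℝ A} {g : Γ} {X : A} (hX : X ∈ 𝔤)
    (hg : ρ g = exp X) : g ∈ expSubgroup ρ 𝔤 :=
  Subgroup.subset_closure ⟨X, hX, hg⟩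

theorem expSubgroup_mono (ρ : Γ →* A) {𝔤 𝔥 : Submodule ℝ A} (h : 𝔤 ≤ 𝔥) :
    expSubgroup ρ 𝔤 ≤ expSubgroup ρ 𝔥 :=
  Subgroup.closure_mono fun _ ⟨X, hX, hg⟩ => ⟨X, h hX, hg⟩

variable [CompleteSpace A]

theorem map_inv_eq_exp_neg {ρ : Γ →* A} {g : Γ} {X : A} (hg : ρ g = exp X) :
    ρ g⁻¹ = exp (-X) := by
  rw [← mul_one (ρ g⁻¹), ← exp_neg_mul_exp (-X), neg_neg, ← hg, ← mul_assoc, ← map_mul,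
    inv_mul_cancel, map_one, one_mul]

theorem map_mem_of_mem_expSubgroup {ρ : Γ →* A} {𝔤 : Submodule ℝ A} {S : Submonoid A}
    (hS : ∀ X ∈ 𝔤, exp X ∈ S) {g : Γ} (hg : g ∈ expSubgroup ρ 𝔤) : ρ g ∈ S := by
  induction hg using Subgroup.closure_induction_right with
  | one => exact (map_one ρ).symm ▸ S.one_mem
  | mul_right x _ y hy hx =>
    obtain ⟨X, hX, hy⟩ := hy
    exact map_mul ρ x y ▸ S.mul_mem hx (hy ▸ hS X hX)
  | mul_inv_cancel x _ y hy hx =>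
    obtain ⟨X, hX, hy⟩ := hy
    exact map_mul ρ x y⁻¹ ▸ S.mul_mem hx (map_inv_eq_exp_neg hy ▸ hS _ (𝔤.neg_mem hX))

theorem commute_of_mem_expSubgroup {ρ : Γ →* A} (hρ : Function.Injective ρ) {𝔤 𝔥 : Submodule ℝ A}
    (hcomm : ∀ X ∈ 𝔤, ∀ Y ∈ 𝔥, Commute X Y) {g h : Γ} (hg : g ∈ expSubgroup ρ 𝔤)
    (hh : h ∈ expSubgroup ρ 𝔥) : Commute g h := by
  have hgY (Y : A) (hY : Y ∈ 𝔥) : Commute (exp Y) (ρ g) :=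
    map_mem_of_mem_expSubgroup (S := Submonoid.centralizer {exp Y})
      (by rintro X hX _ rfl; exact (hcomm X hX Y hY).symm.exp_left.exp_right) hg _ rfl
  have hgh : Commute (ρ g) (ρ h) :=
    map_mem_of_mem_expSubgroup (S := Submonoid.centralizer {ρ g})
      (by rintro Y hY _ rfl; exact (hgY Y hY).symm) hh _ rfl
  exact hρ (by rw [map_mul, map_mul, hgh.eq])

theorem expSubgroup_sup {ρ : Γ →* A} {𝔤 𝔥 : Submodule ℝ A} (hcomm : ∀ X ∈ 𝔤, ∀ Y ∈ 𝔥, Commute X Y)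
    (hexp : ∀ X ∈ 𝔤, ∃ g, ρ g = exp X) :
    expSubgroup ρ (𝔤 ⊔ 𝔥) = expSubgroup ρ 𝔤 ⊔ expSubgroup ρ 𝔥 := by
  refine le_antisymm ((Subgroup.closure_le _).2 ?_)
    (sup_le (expSubgroup_mono ρ le_sup_left) (expSubgroup_mono ρ le_sup_right))
  rintro k ⟨Z, hZ, hk⟩
  obtain ⟨X, hX, Y, hY, rfl⟩ := Submodule.mem_sup.1 hZ
  obtain ⟨g, hg⟩ := hexp X hX
  have hgk : ρ (g⁻¹ * k) = exp Y := by
    rw [map_mul, map_inv_eq_exp_neg hg, hk, exp_add_of_commute_real (hcomm X hX Y hY),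
      ← mul_assoc, exp_neg_mul_exp, one_mul]
  rw [← mul_inv_cancel_left g k]
  exact Subgroup.mul_mem_sup (mem_expSubgroup_of_eq_exp hX hg) (mem_expSubgroup_of_eq_exp hY hgk)

theorem isDirectProd_expSubgroup {ρ : Γ →* A} (hρ : Function.Injective ρ) {𝔤 𝔥 : Submodule ℝ A}
    (hcomm : ∀ X ∈ 𝔤, ∀ Y ∈ 𝔥, Commute X Y) (hexp : ∀ X ∈ 𝔤, ∃ g, ρ g = exp X)
    (hdisj : Disjoint (expSubgroup ρ 𝔤) (expSubgroup ρ 𝔥)) :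
    IsDirectProd (expSubgroup ρ 𝔤) (expSubgroup ρ 𝔥) (expSubgroup ρ (𝔤 ⊔ 𝔥)) :=
  ⟨fun _ hg _ hh => commute_of_mem_expSubgroup hρ hcomm hg hh, hdisj, expSubgroup_sup hcomm hexp⟩

theorem map_conj_expSubgroup {V : Type*} [AddCommGroup V] [Module ℝ V] {ρ : Γ →* A} {c : Γ}
    {ι κ : V →ₗ[ℝ] A} (h : ∀ p, κ p = ρ c * ι p * ρ c⁻¹) (𝔰 : Submodule ℝ V) :
    (expSubgroup ρ (𝔰.map ι)).map (MulAut.conj c).toMonoidHom = expSubgroup ρ (𝔰.map κ) := by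
  have hc : ρ c * ρ c⁻¹ = 1 := by rw [← map_mul, mul_inv_cancel, map_one]
  have hc' : ρ c⁻¹ * ρ c = 1 := by rw [← map_mul, inv_mul_cancel, map_one]
  rw [expSubgroup, expSubgroup, MonoidHom.map_closure]
  congr 1
  ext k
  constructor
  · rintro ⟨g, ⟨_, ⟨p, hp, rfl⟩, hg⟩, rfl⟩
    refine ⟨κ p, Submodule.mem_map_of_mem hp, ?_⟩
    rw [h, exp_conj_of_mul_eq_one hc hc', ← hg, ← map_mul, ← map_mul]
    rfl
  · rintro ⟨_, ⟨p, hp, rfl⟩, hk⟩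
    refine ⟨c⁻¹ * k * c, ⟨ι p, Submodule.mem_map_of_mem hp, ?_⟩, by simp [mul_assoc]⟩
    rw [map_mul, map_mul, hk, h, exp_conj_of_mul_eq_one hc hc', mul_assoc, mul_assoc, hc', mul_one,
      ← mul_assoc, hc', one_mul]

theorem apply_mem_of_mem_expSubgroup {F : Type*} [NormedAddCommGroup F] [NormedSpace ℝ F]
    [CompleteSpace F] {ρ : Γ →* (F →L[ℝ] F)} {𝔤 : Submodule ℝ (F →L[ℝ] F)} {M : Submodule ℝ F}
    (hM : IsClosed (M : Set F)) (h : ∀ X ∈ 𝔤, ∀ x ∈ M, X x ∈ M) {g : Γ}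
    (hg : g ∈ expSubgroup ρ 𝔤) {x : F} (hx : x ∈ M) : ρ g x ∈ M := by
  let S : Submonoid (F →L[ℝ] F) :=
    { carrier := {T | ∀ x ∈ M, T x ∈ M}
      one_mem' := fun _ hx => hx
      mul_mem' := fun hT hT' x hx => hT _ (hT' x hx) }
  exact map_mem_of_mem_expSubgroup (S := S) (fun X hX _ => exp_apply_mem hM (h X hX)) hg x hx

end ExpSubgroup

/-! ### Infinitesimal rotations and similarities -/

theorem commutator_sub_smul_one {R A : Type*} [CommRing R] [Ring A] [Algebra R A] (x y : A)
    (s : R) :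
    (x - s • 1) * y - y * (x - s • 1) = x * y - y * x := by
  simp [sub_mul, mul_sub]

section SkewOperators

variable {E : Type*} [NormedAddCommGroup E] [InnerProductSpace ℝ E] [CompleteSpace E]

variable (E) in
/-- The space `𝔰𝔬(E)` of skew-adjoint operators. -/
noncomputable abbrev skewOps : Submodule ℝ (E →L[ℝ] E) :=
  skewAdjoint.submodule ℝ (E →L[ℝ] E)

variable (E) in
/-- The space `ℝ ⊕ 𝔰𝔬(E)` of the operators that generate linear similarities. -/
noncomputable abbrev confOps : Submodule ℝ (E →L[ℝ] E) :=
  ℝ ∙ (1 : E →L[ℝ] E) ⊔ skewOps E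

theorem mem_skewOps_iff {A : E →L[ℝ] E} : A ∈ skewOps E ↔ ∀ x y, ⟪A x, y⟫_ℝ = -⟪x, A y⟫_ℝ := by
  have hA : A ∈ skewOps E ↔ A = star (-A) := by
    rw [star_neg, ← neg_eq_iff_eq_neg, eq_comm]
    exact Iff.rfl
  rw [hA, ContinuousLinearMap.star_eq_adjoint, ContinuousLinearMap.eq_adjoint_iff]
  simp only [neg_apply, inner_neg_right]

theorem mem_skewOps_iff_inner_self {A : E →L[ℝ] E} : A ∈ skewOps E ↔ ∀ x, ⟪x, A x⟫_ℝ = 0 := by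
  rw [mem_skewOps_iff]
  refine ⟨fun h x => ?_, fun h x y => ?_⟩
  · linarith [h x x, real_inner_comm x (A x)]
  · have hxy := h (x + y)
    rw [map_add, inner_add_left, inner_add_right, inner_add_right, h x, h y] at hxy
    linarith [real_inner_comm y (A x)]

theorem mem_confOps_iff {B : E →L[ℝ] E} : B ∈ confOps E ↔ ∃ s : ℝ, B - s • 1 ∈ skewOps E := by
  rw [Submodule.mem_sup]
  constructor
  · rintro ⟨_, hs, A, hA, rfl⟩
    obtain ⟨s, rfl⟩ := Submodule.mem_span_singleton.1 hs
    exact ⟨s, by rwa [add_sub_cancel_left]⟩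
  · rintro ⟨s, hA⟩
    exact ⟨s • 1, Submodule.mem_span_singleton.2 ⟨s, rfl⟩, _, hA, add_sub_cancel _ _⟩

theorem mem_confOps_of_inner_self {B : E →L[ℝ] E}
    (h : ∀ x y : E, ‖x‖ = ‖y‖ → ⟪x, B x⟫_ℝ = ⟪y, B y⟫_ℝ) : B ∈ confOps E := by
  rcases subsingleton_or_nontrivial E with hE | hE
  · rw [Subsingleton.elim B 0]
    exact zero_mem _
  obtain ⟨e, he⟩ := exists_norm_eq E zero_le_one
  refine mem_confOps_iff.2 ⟨⟪e, B e⟫_ℝ, mem_skewOps_iff_inner_self.2 fun x => ?_⟩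
  have hx := h x (‖x‖ • e) (by rw [norm_smul, norm_norm, he, mul_one])
  rw [map_smul, real_inner_smul_left, real_inner_smul_right] at hx
  rw [sub_apply, inner_sub_right, hx, smul_apply, one_apply_eq_self,
    real_inner_smul_right, real_inner_self_eq_norm_sq]
  ring

theorem mul_sub_mul_mem_skewOps {B C : E →L[ℝ] E} (hB : B ∈ confOps E) (hC : C ∈ confOps E) :
    B * C - C * B ∈ skewOps E := by
  obtain ⟨s, hA⟩ := mem_confOps_iff.1 hB
  obtain ⟨t, hA'⟩ := mem_confOps_iff.1 hC
  have hstar : star (B - s • 1) = -(B - s • 1) := hA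
  have hstar' : star (C - t • 1) = -(C - t • 1) := hA'
  rw [← commutator_sub_smul_one B C s, ← neg_sub, ← commutator_sub_smul_one C _ t]
  change star _ = -_
  rw [star_neg, star_sub, star_mul, star_mul, hstar, hstar', neg_mul_neg, neg_mul_neg, neg_sub,
    neg_neg]

theorem apply_mem_orthogonal_of_mem_confOps {B : E →L[ℝ] E} (hB : B ∈ confOps E)
    {V : Submodule ℝ E} (hV : ∀ v ∈ V, B v ∈ V) {x : E} (hx : x ∈ Vᗮ) : B x ∈ Vᗮ := by
  obtain ⟨s, hA⟩ := mem_confOps_iff.1 hB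
  intro v hv
  have hskew := mem_skewOps_iff.1 hA v x
  have hinv : ⟪B v - s • v, x⟫_ℝ = 0 := hx _ (V.sub_mem (hV v hv) (V.smul_mem s hv))
  rw [sub_apply, smul_apply, one_apply_eq_self, hinv, sub_apply, smul_apply, one_apply_eq_self,
    inner_sub_right, real_inner_smul_right, hx v hv] at hskew
  linarith

theorem injective_one_add {A : E →L[ℝ] E} (hA : A ∈ skewOps E) :
    Function.Injective (1 + A : E →L[ℝ] E) := by
  rw [injective_iff_map_eq_zero]
  intro x hx
  have h := congrArg (inner ℝ x) hx
  rwa [add_apply, one_apply_eq_self, inner_add_right, mem_skewOps_iff_inner_self.1 hA, add_zero,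
    inner_zero_right, inner_self_eq_zero] at h

end SkewOperators

section HilbertSchmidt

variable {E : Type*} [NormedAddCommGroup E] [InnerProductSpace ℝ E] [FiniteDimensional ℝ E]

variable (E) in
/-- The operator `B` as the family of the vectors `B eₖ` for an orthonormal basis `e`. The inner
product of these families is the Hilbert–Schmidt inner product of operators. -/
noncomputable def hsFamily :
    (E →L[ℝ] E) →ₗ[ℝ] PiLp 2 (fun _ : Fin (Module.finrank ℝ E) => E) where
  toFun B := WithLp.toLp 2 fun k => B (stdOrthonormalBasis ℝ E k)
  map_add' _ _ := rfl
  map_smul' _ _ := rfl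

theorem hsFamily_injective : Function.Injective (hsFamily E) := fun B C h =>
  ContinuousLinearMap.coe_injective <| (stdOrthonormalBasis ℝ E).toBasis.ext fun k => by
    rw [OrthonormalBasis.coe_toBasis]
    exact congrArg (fun v : PiLp 2 (fun _ => E) => v k) h

theorem inner_hsFamily_eq_trace (B C : E →L[ℝ] E) :
    ⟪hsFamily E B, hsFamily E C⟫_ℝ =
      LinearMap.trace ℝ E ((star B * C : E →L[ℝ] E) : E →ₗ[ℝ] E) := by
  rw [LinearMap.trace_eq_sum_inner _ (stdOrthonormalBasis ℝ E), PiLp.inner_apply]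
  refine Finset.sum_congr rfl fun k _ => ?_
  exact (ContinuousLinearMap.adjoint_inner_right B _ _).symm

theorem inner_hsFamily_mul_left {A : E →L[ℝ] E} (hA : A ∈ skewOps E) (B C : E →L[ℝ] E) :
    ⟪hsFamily E (A * B), hsFamily E C⟫_ℝ = -⟪hsFamily E B, hsFamily E (A * C)⟫_ℝ := by
  rw [PiLp.inner_apply, PiLp.inner_apply, ← Finset.sum_neg_distrib]
  exact Finset.sum_congr rfl fun k _ => mem_skewOps_iff.1 hA _ _

theorem inner_hsFamily_mul_right {A : E →L[ℝ] E} (hA : A ∈ skewOps E) (B C : E →L[ℝ] E) :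
    ⟪hsFamily E (B * A), hsFamily E C⟫_ℝ = -⟪hsFamily E B, hsFamily E (C * A)⟫_ℝ := by
  have hstar : star A = -A := hA
  rw [inner_hsFamily_eq_trace, inner_hsFamily_eq_trace, star_mul, hstar, neg_mul, neg_mul,
    mul_assoc, ContinuousLinearMap.toLinearMap_neg, map_neg, ContinuousLinearMap.toLinearMap_mul,
    LinearMap.trace_mul_comm, ← ContinuousLinearMap.toLinearMap_mul, mul_assoc]

theorem inner_hsFamily_commutator {B : E →L[ℝ] E} (hB : B ∈ confOps E) (C D : E →L[ℝ] E) :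
    ⟪hsFamily E (B * C - C * B), hsFamily E D⟫_ℝ =
      -⟪hsFamily E C, hsFamily E (B * D - D * B)⟫_ℝ := by
  obtain ⟨s, hA⟩ := mem_confOps_iff.1 hB
  rw [← commutator_sub_smul_one B C s, ← commutator_sub_smul_one B D s, map_sub, map_sub,
    inner_sub_left, inner_sub_right, inner_hsFamily_mul_left hA, inner_hsFamily_mul_right hA,
    neg_sub_neg, neg_sub]

theorem exists_central_complement {𝔩 𝔥 : Submodule ℝ (E →L[ℝ] E)} (h𝔩 : 𝔩 ≤ confOps E)
    (h𝔥 : 𝔥 ≤ 𝔩) (hcomm : ∀ B ∈ 𝔩, ∀ C ∈ 𝔩, B * C - C * B ∈ 𝔥) :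
    ∃ 𝔲 : Submodule ℝ (E →L[ℝ] E), Disjoint 𝔲 𝔥 ∧ 𝔲 ⊔ 𝔥 = 𝔩 ∧
      ∀ B ∈ 𝔩, ∀ C ∈ 𝔲, Commute B C := by
  have hzero {B : E →L[ℝ] E} (hB : ⟪hsFamily E B, hsFamily E B⟫_ℝ = 0) : B = 0 :=
    hsFamily_injective (by rw [inner_self_eq_zero.1 hB, map_zero])
  set 𝔲 := 𝔩 ⊓ ((𝔥.map (hsFamily E))ᗮ).comap (hsFamily E)
  have horth {A B : E →L[ℝ] E} (hA : A ∈ 𝔥) (hB : B ∈ 𝔲) : ⟪hsFamily E B, hsFamily E A⟫_ℝ = 0 :=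
    Submodule.inner_left_of_mem_orthogonal (Submodule.mem_map_of_mem hA) hB.2
  refine ⟨𝔲, ?_, le_antisymm (sup_le inf_le_left h𝔥) fun B hB => ?_, fun B hB C hC => ?_⟩
  · exact Submodule.disjoint_def.2 fun B hB hB' => hzero (horth hB' hB)
  · obtain ⟨A, hA, hAB⟩ := (𝔥.map (hsFamily E)).starProjection_apply_mem (hsFamily E B)
    refine Submodule.mem_sup.2 ⟨B - A, ⟨𝔩.sub_mem hB (h𝔥 hA), ?_⟩, A, hA, sub_add_cancel B A⟩
    rw [SetLike.mem_coe, Submodule.mem_comap, map_sub, hAB]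
    exact Submodule.sub_starProjection_mem_orthogonal _
  · refine sub_eq_zero.1 (hzero ?_)
    -- `⟪[B, C], [B, C]⟫ = -⟪C, [B, [B, C]]⟫`, and the double commutator lies in `𝔥`.
    rw [inner_hsFamily_commutator (h𝔩 hB), neg_eq_zero]
    exact horth (hcomm _ hB _ (h𝔥 (hcomm _ hB _ hC.1))) hC

end HilbertSchmidt

/-! ### Rotations as exponentials -/

section ExpOrth

variable {E : Type*} [NormedAddCommGroup E] [InnerProductSpace ℝ E]

theorem exp_mem_unitary_of_mem_skewOps [CompleteSpace E] {A : E →L[ℝ] E} (hA : A ∈ skewOps E) :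
    exp A ∈ unitary (E →L[ℝ] E) := by
  let _ := NormedAlgebra.restrictScalars ℚ ℝ (E →L[ℝ] E)
  exact NormedSpace.exp_mem_unitary_of_mem_skewAdjoint hA

/-- The exponential of a skew operator as a linear isometry. -/
noncomputable def expOrth [CompleteSpace E] (A : E →L[ℝ] E) (hA : A ∈ skewOps E) : E ≃ₗᵢ[ℝ] E :=
  Unitary.linearIsometryEquiv ⟨exp A, exp_mem_unitary_of_mem_skewOps hA⟩

theorem expOrth_apply [CompleteSpace E] {A : E →L[ℝ] E} (hA : A ∈ skewOps E) (x : E) :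
    expOrth A hA x = exp A x :=
  rfl

theorem expOrth_add [CompleteSpace E] {A B : E →L[ℝ] E} (hA : A ∈ skewOps E) (hB : B ∈ skewOps E)
    (hAB : Commute A B) :
    expOrth (A + B) (add_mem hA hB) = expOrth A hA * expOrth B hB := by
  ext x
  rw [expOrth_apply, exp_add_of_commute_real hAB]
  rfl

theorem det_mul_self_linearIsometryEquiv [FiniteDimensional ℝ E] (f : E ≃ₗᵢ[ℝ] E) :
    LinearMap.det ((f * f).toLinearEquiv : E →ₗ[ℝ] E) = 1 := by
  have hf := Matrix.det_of_mem_unitary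
    (f.toMatrix_mem_unitaryGroup (stdOrthonormalBasis ℝ E) (stdOrthonormalBasis ℝ E))
  rw [LinearMap.det_toMatrix] at hf
  exact (LinearMap.det.map_mul _ _).trans (by simpa using (Unitary.mem_iff.1 hf).1)

theorem det_expOrth [FiniteDimensional ℝ E] {A : E →L[ℝ] E} (hA : A ∈ skewOps E) :
    LinearMap.det ((expOrth A hA).toLinearEquiv : E →ₗ[ℝ] E) = 1 := by
  have hhalf : (1 / 2 : ℝ) • A ∈ skewOps E := Submodule.smul_mem _ _ hA
  have hsq : expOrth A hA = expOrth _ hhalf * expOrth _ hhalf := by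
    rw [← expOrth_add hhalf hhalf rfl]
    congr 1
    module
  rw [hsq, det_mul_self_linearIsometryEquiv]

/-- The homomorphism `u ↦ exp (γ u)` into the orthogonal group, for an additive map `γ` into
commuting skew operators. -/
noncomputable def expHom [CompleteSpace E] {M : Type*} [AddMonoid M] (γ : M →+ (E →L[ℝ] E))
    (hγ : ∀ u, γ u ∈ skewOps E) (hcomm : ∀ u v, Commute (γ u) (γ v)) :
    Multiplicative M →* (E ≃ₗᵢ[ℝ] E) where
  toFun u := expOrth (γ u.toAdd) (hγ _)
  map_one' := by
    ext x
    simp [expOrth_apply]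
  map_mul' u v := by
    rw [← expOrth_add _ _ (hcomm _ _)]
    congr 1
    exact γ.map_add _ _

end ExpOrth

section Rotations

variable {n : ℕ}

theorem linRep_injective (n : ℕ) : Function.Injective (linRep n) := fun _ _ h =>
  LinearIsometryEquiv.ext fun x => congrArg (fun T : Euc n →L[ℝ] Euc n => T x) h

theorem linRep_expOrth {A : Euc n →L[ℝ] Euc n} (hA : A ∈ skewOps (Euc n)) :
    linRep n (expOrth A hA) = exp A :=
  rfl

theorem expOrth_mem_SOGroup {A : Euc n →L[ℝ] Euc n} (hA : A ∈ skewOps (Euc n)) :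
    expOrth A hA ∈ SOGroup n :=
  det_expOrth hA

theorem expOrth_mem_SOSub {W : Submodule ℝ (Euc n)} {A : Euc n →L[ℝ] Euc n}
    (hA : A ∈ skewOps (Euc n)) (hW : ∀ x ∈ Wᗮ, A x = 0) : expOrth A hA ∈ SOSub W :=
  ⟨expOrth_mem_SOGroup hA, fun x hx => exp_apply_of_apply_eq_zero (hW x hx)⟩

theorem expSubgroup_linRep_le_SOSub {W : Submodule ℝ (Euc n)}
    {𝔥 : Submodule ℝ (Euc n →L[ℝ] Euc n)} (h𝔥 : 𝔥 ≤ skewOps (Euc n))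
    (hW : ∀ A ∈ 𝔥, ∀ x ∈ Wᗮ, A x = 0) : expSubgroup (linRep n) 𝔥 ≤ SOSub W := by
  refine (Subgroup.closure_le _).2 ?_
  rintro f ⟨A, hA, hf⟩
  rw [linRep_injective n (hf.trans (linRep_expOrth (h𝔥 hA)).symm)]
  exact expOrth_mem_SOSub (h𝔥 hA) (hW A hA)

theorem isConnectedLieSubgroup_expSubgroup_linRep {𝔥 : Submodule ℝ (Euc n →L[ℝ] Euc n)}
    (h𝔥 : 𝔥 ≤ skewOps (Euc n)) (hbr : ∀ A ∈ 𝔥, ∀ B ∈ 𝔥, A * B - B * A ∈ 𝔥) :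
    IsConnectedLieSubgroup (linRep n) (expSubgroup (linRep n) 𝔥) :=
  ⟨𝔥, hbr, fun _ hA => ⟨_, linRep_expOrth (h𝔥 hA)⟩, rfl⟩

end Rotations

/-! ### Affine vector fields -/

/-- Affine vector fields `x ↦ B x + b` on `E`, as pairs `(B, b)`. -/
abbrev AffineField (E : Type*) [NormedAddCommGroup E] [NormedSpace ℝ E] : Type _ :=
  (E →L[ℝ] E) × E

namespace AffineField

section Field

variable {E : Type*} [NormedAddCommGroup E] [NormedSpace ℝ E]

variable (E) in
/-- The affine field `x ↦ B x + b` as the linear field `(x, t) ↦ (B x + t b, 0)` on `E × ℝ`, whose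
flow restricts to the affine flow on the hyperplane `t = 1`. -/
noncomputable def toEnd : AffineField E →ₗ[ℝ] (E × ℝ →L[ℝ] E × ℝ) where
  toFun p := (p.1.comp (.fst ℝ E ℝ) + (ContinuousLinearMap.snd ℝ E ℝ).smulRight p.2).prod 0
  map_add' p q := by
    ext x <;> simp
  map_smul' c p := by
    ext x <;> simp

theorem toEnd_apply (p : AffineField E) (z : E × ℝ) : toEnd E p z = (p.1 z.1 + z.2 • p.2, 0) :=
  rfl

theorem toEnd_injective : Function.Injective (toEnd E) := by
  intro p q h
  have hz (z : E × ℝ) : p.1 z.1 + z.2 • p.2 = q.1 z.1 + z.2 • q.2 :=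
    congrArg (fun T : E × ℝ →L[ℝ] E × ℝ => (T z).1) h
  exact Prod.ext (ContinuousLinearMap.ext fun x => by simpa using hz (x, 0))
    (by simpa using hz (0, 1))

/-- The bracket of affine fields, with the sign of the commutator in `End (E × ℝ)`. -/
noncomputable def bracket (p q : AffineField E) : AffineField E :=
  (p.1 * q.1 - q.1 * p.1, p.1 q.2 - q.1 p.2)

theorem toEnd_bracket (p q : AffineField E) :
    toEnd E (bracket p q) = toEnd E p * toEnd E q - toEnd E q * toEnd E p := by
  refine ContinuousLinearMap.ext fun z => Prod.ext ?_ (sub_self (0 : ℝ)).symm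
  change (p.1 (q.1 z.1) - q.1 (p.1 z.1)) + z.2 • (p.1 q.2 - q.1 p.2) =
    (p.1 (q.1 z.1 + z.2 • q.2) + (0 : ℝ) • p.2) - (q.1 (p.1 z.1 + z.2 • p.2) + (0 : ℝ) • q.2)
  simp only [map_add, map_smul, zero_smul, smul_sub]
  abel

/-- The translation by `q` transports the field `p` to `transport q p`. -/
noncomputable def transport (q : E) : AffineField E →ₗ[ℝ] AffineField E :=
  (LinearMap.fst ℝ _ _).prod (LinearMap.snd ℝ _ _ -
    (ContinuousLinearMap.apply ℝ E q : (E →L[ℝ] E) →ₗ[ℝ] E) ∘ₗ LinearMap.fst ℝ _ _)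

theorem transport_apply (q : E) (p : AffineField E) : transport q p = (p.1, p.2 - p.1 q) :=
  rfl

variable [CompleteSpace E]

theorem exp_toEnd_inl (p : AffineField E) (x : E) : exp (toEnd E p) (x, 0) = (exp p.1 x, 0) :=
  exp_apply_of_intertwines (.inl ℝ E ℝ) (fun y => by simp [toEnd_apply]) x

theorem exp_toEnd_one (p : AffineField E) (x : E) :
    exp (toEnd E p) (x, 1) = (exp p.1 x, 0) + exp (toEnd E p) (0, 1) := by
  rw [← exp_toEnd_inl, ← map_add, Prod.mk_add_mk, add_zero, zero_add]

theorem snd_exp_toEnd (p : AffineField E) (z : E × ℝ) : (exp (toEnd E p) z).2 = z.2 := by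
  have h := exp_apply_of_intertwines (.snd ℝ E ℝ) (X := toEnd E p) (Y := 0) (fun _ => rfl) z
  rw [NormedSpace.exp_zero] at h
  exact h.symm

theorem exp_toEnd_zero_one {p : AffineField E} (hp : p.1 p.2 = 0) :
    exp (toEnd E p) (0, 1) = (p.2, 1) := by
  rw [exp_apply_of_apply_apply_eq_zero] <;> simp [toEnd_apply, hp]

end Field

end AffineField

section AffineGroup

open AffineField

variable {n : ℕ}

theorem affGroup_apply (g : AffGroup n) (x : Euc n) : g x = g.linear x + g 0 := by
  simpa using g.map_vadd 0 x

theorem affRep_apply (g : AffGroup n) (z : Euc n × ℝ) :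
    affRep n g z = (g.linear z.1 + z.2 • g 0, z.2) :=
  rfl

theorem affRep_eq_iff {g : AffGroup n} {T : Euc n × ℝ →L[ℝ] Euc n × ℝ} :
    affRep n g = T ↔ ∀ x, T (x, 1) = (g x, 1) := by
  have hone (x : Euc n) : affRep n g (x, 1) = (g x, 1) := by
    rw [affRep_apply, one_smul, ← affGroup_apply]
  refine ⟨fun h x => h ▸ hone x, fun h => ContinuousLinearMap.ext fun z => ?_⟩
  have hz : z = (z.1, 1) + (z.2 - 1) • ((0 : Euc n), (1 : ℝ)) := by ext <;> simp
  rw [hz, map_add, map_add, map_smul, map_smul, hone, hone, h, h]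

theorem affRep_injective (n : ℕ) : Function.Injective (affRep n) := fun _ _ h =>
  AffineEquiv.ext fun x => congrArg Prod.fst
    ((affRep_eq_iff.1 rfl x).symm.trans (affRep_eq_iff.1 h.symm x))

theorem linear_eq_exp {g : AffGroup n} {p : AffineField (Euc n)}
    (hg : affRep n g = exp (toEnd (Euc n) p)) (x : Euc n) : g.linear x = exp p.1 x := by
  have h := exp_toEnd_inl p x
  rw [← hg, affRep_apply, zero_smul, add_zero] at h
  exact congrArg Prod.fst h

theorem affRep_eq_exp_iff {g : AffGroup n} {p : AffineField (Euc n)} (hp : p.1 p.2 = 0) :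
    affRep n g = exp (toEnd (Euc n) p) ↔ ∀ x, g x = exp p.1 x + p.2 := by
  rw [affRep_eq_iff]
  refine forall_congr' fun x => ?_
  rw [exp_toEnd_one, exp_toEnd_zero_one hp, Prod.mk_add_mk, zero_add, Prod.mk.injEq, eq_comm,
    and_iff_left rfl]

theorem exists_affRep_eq_exp (p : AffineField (Euc n)) :
    ∃ g, affRep n g = exp (toEnd (Euc n) p) := by
  have hinv (B : Euc n →L[ℝ] Euc n) (x : Euc n) : exp (-B) (exp B x) = x :=
    congrArg (fun T : Euc n →L[ℝ] Euc n => T x) (exp_neg_mul_exp B)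
  let L : Euc n ≃ₗ[ℝ] Euc n :=
    { ((exp p.1 : Euc n →L[ℝ] Euc n) : Euc n →ₗ[ℝ] Euc n) with
      invFun := (exp (-p.1) : Euc n →L[ℝ] Euc n)
      left_inv := hinv p.1
      right_inv := fun x => by simpa using hinv (-p.1) x }
  refine ⟨L.toAffineEquiv.trans (.constVAdd ℝ (Euc n) (exp (toEnd (Euc n) p) (0, 1)).1),
    affRep_eq_iff.2 fun x => ?_⟩
  rw [exp_toEnd_one]
  refine Prod.ext (add_comm _ _) ?_
  simp [snd_exp_toEnd]

/-- The subgroup of the affine group generated by the exponentials of the affine fields in `𝔰`. -/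
noncomputable def affExpSubgroup (𝔰 : Submodule ℝ (AffineField (Euc n))) : Subgroup (AffGroup n) :=
  expSubgroup (affRep n) (𝔰.map (toEnd (Euc n)))

theorem affExpSubgroup_eq_closure (𝔰 : Submodule ℝ (AffineField (Euc n))) :
    affExpSubgroup 𝔰 = Subgroup.closure {g | ∃ p ∈ 𝔰, affRep n g = exp (toEnd (Euc n) p)} := by
  simp only [affExpSubgroup, expSubgroup, Submodule.mem_map, exists_exists_and_eq_and]

theorem mem_affExpSubgroup_of_eq_exp {𝔰 : Submodule ℝ (AffineField (Euc n))} {g : AffGroup n}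
    {p : AffineField (Euc n)} (hp : p ∈ 𝔰) (hg : affRep n g = exp (toEnd (Euc n) p)) :
    g ∈ affExpSubgroup 𝔰 :=
  mem_expSubgroup_of_eq_exp (Submodule.mem_map_of_mem hp) hg

theorem linear_apply_mem_of_mem_affExpSubgroup {𝔰 : Submodule ℝ (AffineField (Euc n))}
    {V : Submodule ℝ (Euc n)} (hV : ∀ p ∈ 𝔰, ∀ v ∈ V, p.1 v ∈ V) {g : AffGroup n}
    (hg : g ∈ affExpSubgroup 𝔰) {v : Euc n} (hv : v ∈ V) : g.linear v ∈ V := by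
  have hmem : affRep n g (v, 0) ∈ V.prod (⊥ : Submodule ℝ ℝ) := by
    refine apply_mem_of_mem_expSubgroup (Submodule.closed_of_finiteDimensional _) ?_ hg
      ⟨hv, Submodule.zero_mem _⟩
    rintro _ ⟨p, hp, rfl⟩ ⟨x, t⟩ ⟨hx, ht⟩
    obtain rfl : t = 0 := ht
    exact ⟨by simpa [toEnd_apply] using hV p hp x hx, Submodule.zero_mem _⟩
  simpa [affRep_apply] using hmem.1

theorem apply_sub_mem_of_mem_affExpSubgroup {𝔰 : Submodule ℝ (AffineField (Euc n))}
    {V : Submodule ℝ (Euc n)} {x₀ : Euc n} (hV : ∀ p ∈ 𝔰, ∀ v ∈ V, p.1 v ∈ V)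
    (hx₀ : ∀ p ∈ 𝔰, p.1 x₀ + p.2 ∈ V) {g : AffGroup n} (hg : g ∈ affExpSubgroup 𝔰) :
    g x₀ - x₀ ∈ V := by
  let M : Submodule ℝ (Euc n × ℝ) := V.comap
    (LinearMap.fst ℝ (Euc n) ℝ - (LinearMap.snd ℝ (Euc n) ℝ).smulRight x₀)
  have hM (z : Euc n × ℝ) : z ∈ M ↔ z.1 - z.2 • x₀ ∈ V := Iff.rfl
  have hmem : affRep n g (x₀, 1) ∈ M := by
    refine apply_mem_of_mem_expSubgroup (Submodule.closed_of_finiteDimensional _) ?_ hg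
      ((hM _).2 (by simp))
    rintro _ ⟨p, hp, rfl⟩ z hz
    have h := V.add_mem (hV p hp _ ((hM z).1 hz)) (V.smul_mem z.2 (hx₀ p hp))
    rw [map_sub, map_smul, smul_add, ← add_assoc, sub_add_cancel] at h
    simpa [hM, toEnd_apply] using h
  simpa [hM, affRep_eq_iff.1 (rfl : affRep n g = _)] using hmem

theorem mul_inv_mem_translations {g k : AffGroup n} {p q : AffineField (Euc n)}
    {V : Submodule ℝ (Euc n)} (hg : affRep n g = exp (toEnd (Euc n) p))
    (hk : affRep n k = exp (toEnd (Euc n) q)) (hpq : p.1 = q.1) (hV : ∀ v ∈ V, p.1 v ∈ V)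
    (hsub : p.2 - q.2 ∈ V) : g * k⁻¹ ∈ translations V := by
  have hzero : g 0 - k 0 ∈ V := by
    have h := exp_sub_exp_apply_mem (M := V.prod (⊥ : Submodule ℝ ℝ))
      (X := toEnd (Euc n) p) (Y := toEnd (Euc n) q) (Submodule.closed_of_finiteDimensional _)
      (by
        rintro ⟨x, t⟩ ⟨hx, ht⟩
        obtain rfl : t = 0 := ht
        exact ⟨by simpa [toEnd_apply] using hV x hx, Submodule.zero_mem _⟩)
      (fun z => ⟨by simpa [toEnd_apply, hpq, smul_sub] using V.smul_mem z.2 hsub,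
        by simp [toEnd_apply]⟩) (0, 1)
    rw [← hg, ← hk] at h
    simpa [affRep_apply] using h.1
  refine ⟨g 0 - k 0, hzero, fun x => ?_⟩
  have hx : k.linear (k.symm x) + k 0 = x := by rw [← affGroup_apply, k.apply_symm_apply]
  change g (k.symm x) = _
  rw [affGroup_apply g, linear_eq_exp hg, hpq, ← linear_eq_exp hk, ← sub_eq_of_eq_add hx.symm]
  abel

theorem translations_eq_affExpSubgroup (V : Submodule ℝ (Euc n)) :
    translations V = affExpSubgroup ((⊥ : Submodule ℝ (Euc n →L[ℝ] Euc n)).prod V) := by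
  have hiff (g : AffGroup n) (v : Euc n) :
      affRep n g = exp (toEnd (Euc n) (0, v)) ↔ ∀ x, g x = x + v := by
    rw [affRep_eq_exp_iff (zero_apply v), NormedSpace.exp_zero]
    rfl
  rw [affExpSubgroup_eq_closure]
  refine le_antisymm ?_ ((Subgroup.closure_le _).2 ?_)
  · rintro g ⟨v, hv, hg⟩
    exact Subgroup.subset_closure ⟨(0, v), ⟨Submodule.zero_mem _, hv⟩, (hiff g v).2 hg⟩
  · rintro g ⟨⟨B, v⟩, ⟨hB, hv⟩, hg⟩
    obtain rfl : B = 0 := hB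
    exact ⟨v, hv, (hiff g v).1 hg⟩

theorem map_rotHom_expSubgroup {𝔥 : Submodule ℝ (Euc n →L[ℝ] Euc n)} (h𝔥 : 𝔥 ≤ skewOps (Euc n)) :
    (expSubgroup (linRep n) 𝔥).map (rotHom n) =
      affExpSubgroup (𝔥.prod (⊥ : Submodule ℝ (Euc n))) := by
  have hiff (g : AffGroup n) (A : Euc n →L[ℝ] Euc n) :
      affRep n g = exp (toEnd (Euc n) (A, 0)) ↔ ∀ x, g x = exp A x := by
    rw [affRep_eq_exp_iff (map_zero A)]
    simp only [add_zero]
  rw [expSubgroup, MonoidHom.map_closure, affExpSubgroup_eq_closure]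
  congr 1
  ext g
  constructor
  · rintro ⟨f, ⟨A, hA, hf⟩, rfl⟩
    exact ⟨(A, 0), ⟨hA, Submodule.zero_mem _⟩, (hiff _ A).2 fun x =>
      congrArg (fun T : Euc n →L[ℝ] Euc n => T x) hf⟩
  · rintro ⟨⟨A, b⟩, ⟨hA, hb⟩, hg⟩
    obtain rfl : b = 0 := hb
    exact ⟨expOrth A (h𝔥 hA), ⟨A, hA, linRep_expOrth _⟩,
      AffineEquiv.ext fun x => ((hiff g A).1 hg x).symm⟩

theorem affExpSubgroup_sup_translations {𝔮 : Submodule ℝ (AffineField (Euc n))}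
    {V : Submodule ℝ (Euc n)} (hV : ∀ q ∈ 𝔮, ∀ v ∈ V, q.1 v ∈ V) :
    affExpSubgroup (𝔮 ⊔ (⊥ : Submodule ℝ (Euc n →L[ℝ] Euc n)).prod V) =
      affExpSubgroup 𝔮 ⊔ translations V := by
  refine le_antisymm ?_ ?_
  · nth_rw 1 [affExpSubgroup_eq_closure]
    refine (Subgroup.closure_le _).2 ?_
    rintro g ⟨p, hp, hg⟩
    obtain ⟨q, hq, ⟨B, v⟩, ⟨hB, hv⟩, rfl⟩ := Submodule.mem_sup.1 hp
    obtain rfl : B = 0 := hB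
    obtain ⟨k, hk⟩ := exists_affRep_eq_exp q
    have hgk : g * k⁻¹ ∈ translations V :=
      mul_inv_mem_translations hg hk (add_zero q.1) (by simpa using hV q hq) (by simpa using hv)
    rw [← inv_mul_cancel_right g k, sup_comm]
    exact Subgroup.mul_mem_sup hgk (mem_affExpSubgroup_of_eq_exp hq hk)
  · rw [translations_eq_affExpSubgroup]
    exact sup_le (expSubgroup_mono _ (Submodule.map_mono le_sup_left))
      (expSubgroup_mono _ (Submodule.map_mono le_sup_right))

theorem isSemidirectProd_affExpSubgroup {𝔮 : Submodule ℝ (AffineField (Euc n))}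
    {V : Submodule ℝ (Euc n)} (hV : ∀ q ∈ 𝔮, ∀ v ∈ V, q.1 v ∈ V)
    (hVo : ∀ q ∈ 𝔮, ∀ v ∈ Vᗮ, q.1 v ∈ Vᗮ) (h𝔮 : ∀ q ∈ 𝔮, q.2 ∈ Vᗮ) :
    IsSemidirectProd (affExpSubgroup 𝔮) (translations V)
      (affExpSubgroup (𝔮 ⊔ (⊥ : Submodule ℝ (Euc n →L[ℝ] Euc n)).prod V)) := by
  refine ⟨?_, ?_, affExpSubgroup_sup_translations hV⟩
  · rintro g hg t ⟨v, hv, ht⟩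
    refine ⟨g.linear v, linear_apply_mem_of_mem_affExpSubgroup hV hg hv, fun x => ?_⟩
    change g (t (g.symm x)) = _
    have h := g.map_vadd (g.symm x) v
    rw [vadd_eq_add, vadd_eq_add, add_comm, add_comm (g.linear v), g.apply_symm_apply] at h
    rw [ht, h]
  · refine Subgroup.disjoint_def.2 fun {g} hg ⟨v, hv, hgv⟩ => ?_
    have hvo : g 0 - 0 ∈ Vᗮ := apply_sub_mem_of_mem_affExpSubgroup hVo
      (fun q hq => by simpa using h𝔮 q hq) hg
    rw [hgv, zero_add, sub_zero] at hvo
    obtain rfl := Submodule.disjoint_def.1 V.orthogonal_disjoint v hv hvo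
    exact AffineEquiv.ext fun x => (hgv x).trans (add_zero x)

theorem map_conj_affExpSubgroup (q : Euc n) (𝔰 : Submodule ℝ (AffineField (Euc n))) :
    (affExpSubgroup 𝔰).map (MulAut.conj (AffineEquiv.constVAdd ℝ (Euc n) q)).toMonoidHom =
      affExpSubgroup (𝔰.map (transport q)) := by
  have hc (z : Euc n × ℝ) :
      affRep n (.constVAdd ℝ (Euc n) q) z = (z.1 + z.2 • q, z.2) := by
    simp [affRep_apply]
  have hc' (z : Euc n × ℝ) :
      affRep n (AffineEquiv.constVAdd ℝ (Euc n) q)⁻¹ z = (z.1 - z.2 • q, z.2) := by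
    simp [affRep_apply, AffineEquiv.inv_def, sub_eq_add_neg]
  rw [affExpSubgroup, affExpSubgroup, ← Submodule.map_comp]
  refine map_conj_expSubgroup (fun p => ContinuousLinearMap.ext fun z => ?_) 𝔰
  change _ = affRep n _ (toEnd (Euc n) p (affRep n _ z))
  rw [hc', hc]
  simp [toEnd_apply, transport_apply, smul_sub]
  abel

end AffineGroup

/-! ### Lie algebras of similarity groups -/

theorem hasDerivAt_exp_smul_apply {F : Type*} [NormedAddCommGroup F] [NormedSpace ℝ F]
    [CompleteSpace F] (X : F →L[ℝ] F) (x : F) :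
    HasDerivAt (fun t : ℝ => exp (t • X) x) (X x) 0 := by
  have h := (hasDerivAt_exp_smul_const (𝕂 := ℝ) X 0).clm_apply (hasDerivAt_const 0 x)
  simpa using h

theorem mem_confOps_of_norm_exp {E : Type*} [NormedAddCommGroup E] [InnerProductSpace ℝ E]
    [CompleteSpace E] {B : E →L[ℝ] E}
    (h : ∀ (t : ℝ) (x y : E), ‖x‖ = ‖y‖ → ‖exp (t • B) x‖ = ‖exp (t • B) y‖) :
    B ∈ confOps E := by
  have hderiv (x : E) :
      HasDerivAt (fun t : ℝ => ‖exp (t • B) x‖ ^ 2) (2 * ⟪x, B x⟫_ℝ) 0 := by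
    simpa using (hasDerivAt_exp_smul_apply B x).norm_sq
  refine mem_confOps_of_inner_self fun x y hxy => ?_
  have heq : (fun t : ℝ => ‖exp (t • B) x‖ ^ 2) = fun t : ℝ => ‖exp (t • B) y‖ ^ 2 :=
    funext fun t => by rw [h t x y hxy]
  have hx := hderiv x
  rw [heq] at hx
  linarith [hx.unique (hderiv y)]

namespace AffineField

variable {E : Type*} [NormedAddCommGroup E]

theorem exists_toEnd_eq [NormedSpace ℝ E] {X : E × ℝ →L[ℝ] E × ℝ} (hX : ∀ z, (X z).2 = 0) :
    ∃ p, toEnd E p = X := by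
  refine ⟨((ContinuousLinearMap.fst ℝ E ℝ).comp (X.comp (.inl ℝ E ℝ)), (X (0, 1)).1),
    ContinuousLinearMap.ext fun z => Prod.ext ?_ (hX z).symm⟩
  have hz : z = (z.1, 0) + z.2 • ((0 : E), (1 : ℝ)) := by ext <;> simp
  conv_rhs => rw [hz, map_add, map_smul]
  rfl

/-- A Lie algebra of infinitesimal similarities: a space of affine fields with conformal linear
parts that is closed under brackets. -/
structure IsSimAlgebra [InnerProductSpace ℝ E] [CompleteSpace E]
    (𝔰 : Submodule ℝ (AffineField E)) : Prop where
  bracket_mem : ∀ p ∈ 𝔰, ∀ q ∈ 𝔰, bracket p q ∈ 𝔰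
  fst_mem_confOps : ∀ p ∈ 𝔰, p.1 ∈ confOps E

/-- No proper affine subspace `x₀ + V` is tangent to all fields in `𝔰`. This is what remains of
the transitivity of a group on the level of its Lie algebra. -/
def IsAffineIrreducible [NormedSpace ℝ E] (𝔰 : Submodule ℝ (AffineField E)) : Prop :=
  ∀ (V : Submodule ℝ E) (x₀ : E),
    (∀ p ∈ 𝔰, ∀ v ∈ V, p.1 v ∈ V) → (∀ p ∈ 𝔰, p.1 x₀ + p.2 ∈ V) → V = ⊤

end AffineField

section SimilarityGroups

open AffineField

variable {n : ℕ}

theorem norm_linear_eq_of_mem_Sim0 {g : AffGroup n} (hg : g ∈ Sim0 n) {x y : Euc n}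
    (hxy : ‖x‖ = ‖y‖) : ‖g.linear x‖ = ‖g.linear y‖ := by
  obtain ⟨a, f, -, v, hg⟩ := hg
  have hlin (z : Euc n) : g.linear z = (a : ℝ) • f z := by
    have hz := affGroup_apply g z
    rw [hg z, hg 0, map_zero, smul_zero, zero_add] at hz
    exact (add_right_cancel hz).symm
  rw [hlin, hlin, norm_smul, norm_smul, f.norm_map, f.norm_map, hxy]

theorem exists_toEnd_eq_of_exp_mem_Sim0 {X : Euc n × ℝ →L[ℝ] Euc n × ℝ}
    (h : ∀ t : ℝ, ∃ g ∈ Sim0 n, affRep n g = exp (t • X)) :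
    ∃ p : AffineField (Euc n), p.1 ∈ confOps (Euc n) ∧ toEnd (Euc n) p = X := by
  have hsnd (z : Euc n × ℝ) : (X z).2 = 0 := by
    have hconst : (fun t : ℝ => (exp (t • X) z).2) = fun _ => z.2 := funext fun t => by
      obtain ⟨g, -, hg⟩ := h t
      rw [← hg, affRep_apply]
    have hderiv := ((ContinuousLinearMap.snd ℝ (Euc n) ℝ).hasFDerivAt).comp_hasDerivAt (0 : ℝ)
      (hasDerivAt_exp_smul_apply X z)
    exact hderiv.unique ((hasDerivAt_const (0 : ℝ) z.2).congr_of_eventuallyEq (.of_eq hconst))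
  obtain ⟨p, rfl⟩ := exists_toEnd_eq hsnd
  refine ⟨p, mem_confOps_of_norm_exp fun t x y hxy => ?_, rfl⟩
  obtain ⟨g, hg, hgt⟩ := h t
  have hlin := linear_eq_exp (p := t • p) ((toEnd (Euc n)).map_smul t p ▸ hgt)
  change ‖exp (t • p).1 x‖ = ‖exp (t • p).1 y‖
  rw [← hlin, ← hlin, norm_linear_eq_of_mem_Sim0 hg hxy]

theorem exists_isSimAlgebra {G : Subgroup (AffGroup n)} (hG : G ≤ Sim0 n)
    (hconn : IsConnectedLieSubgroup (affRep n) G) :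
    ∃ 𝔰 : Submodule ℝ (AffineField (Euc n)), IsSimAlgebra 𝔰 ∧ G = affExpSubgroup 𝔰 := by
  obtain ⟨𝔤, hbr, hexp, rfl⟩ := hconn
  have hgen (X) (hX : X ∈ 𝔤) :
      ∃ p : AffineField (Euc n), p.1 ∈ confOps (Euc n) ∧ toEnd (Euc n) p = X := by
    refine exists_toEnd_eq_of_exp_mem_Sim0 fun t => ?_
    obtain ⟨g, hg⟩ := hexp _ (𝔤.smul_mem t hX)
    exact ⟨g, hG (mem_expSubgroup_of_eq_exp (𝔤.smul_mem t hX) hg), hg⟩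
  have hrange : 𝔤 ≤ LinearMap.range (toEnd (Euc n)) := fun X hX =>
    (hgen X hX).imp fun _ => And.right
  refine ⟨𝔤.comap (toEnd (Euc n)), ⟨fun p hp q hq => ?_, fun p hp => ?_⟩, ?_⟩
  · rw [Submodule.mem_comap, toEnd_bracket]
    exact hbr _ hp _ hq
  · obtain ⟨q, hq, hqp⟩ := hgen _ hp
    rwa [← toEnd_injective hqp]
  · rw [affExpSubgroup, Submodule.map_comap_eq_of_le hrange]
    rfl

theorem isAffineIrreducible_of_transitive {𝔰 : Submodule ℝ (AffineField (Euc n))}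
    (htrans : ∀ x y : Euc n, ∃ g ∈ affExpSubgroup 𝔰, g x = y) : IsAffineIrreducible 𝔰 := by
  intro V x₀ hV hx₀
  refine Submodule.eq_top_iff'.2 fun v => ?_
  obtain ⟨g, hg, hgv⟩ := htrans x₀ (x₀ + v)
  simpa [hgv] using apply_sub_mem_of_mem_affExpSubgroup hV hx₀ hg

end SimilarityGroups

/-! ### Normalization of cocycles -/

theorem exists_eq_sum_inner_smul {V F : Type*} [AddCommGroup V] [Module ℝ V]
    [NormedAddCommGroup F] [InnerProductSpace ℝ F] [FiniteDimensional ℝ F] {τ : V →ₗ[ℝ] F}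
    (hτ : Function.Injective τ) :
    ∃ (m : ℕ) (Z : Fin m → V), ∀ X, X = ∑ i, ⟪τ (Z i), τ X⟫_ℝ • Z i := by
  let e := stdOrthonormalBasis ℝ (LinearMap.range τ)
  let Z i := (LinearEquiv.ofInjective τ hτ).symm (e i)
  have hZ i : τ (Z i) = e i :=
    congrArg Subtype.val ((LinearEquiv.ofInjective τ hτ).apply_symm_apply (e i))
  refine ⟨_, Z, fun X => hτ ?_⟩
  have h := congrArg (Submodule.subtype _) (e.sum_repr' ⟨τ X, LinearMap.mem_range_self τ X⟩)
  rw [map_sum] at h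
  simp only [map_sum, map_smul, hZ]
  exact h.symm

section TupleOperator

variable {E ι : Type*} [NormedAddCommGroup E] [InnerProductSpace ℝ E] [FiniteDimensional ℝ E]
  [Fintype ι]

/-- The operator `v ↦ (B vᵢ - ∑ⱼ rᵢⱼ vⱼ)ᵢ` on tuples of vectors. If `r` is the matrix of `ad B` in
a basis of a Lie algebra, this is the action of `B` on the `E`-valued cochains of degree one. -/
noncomputable def tupleOp (B : E →L[ℝ] E) (r : ι → ι → ℝ) :
    PiLp 2 (fun _ : ι => E) →L[ℝ] PiLp 2 (fun _ : ι => E) :=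
  LinearMap.toContinuousLinearMap
    { toFun v := WithLp.toLp 2 fun i => B (v i) - ∑ j, r i j • v j
      map_add' v w := by
        ext i
        simp only [PiLp.add_apply, map_add, smul_add, Finset.sum_add_distrib]
        abel
      map_smul' c v := by
        ext i
        simp only [PiLp.smul_apply, map_smul, smul_sub, Finset.smul_sum, smul_comm c,
          RingHom.id_apply] }

theorem tupleOp_apply (B : E →L[ℝ] E) (r : ι → ι → ℝ) (v : PiLp 2 (fun _ : ι => E)) (i : ι) :
    tupleOp B r v i = B (v i) - ∑ j, r i j • v j :=
  rfl

theorem tupleOp_mem_skewOps {B : E →L[ℝ] E} (hB : B ∈ skewOps E) {r : ι → ι → ℝ}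
    (hr : ∀ i j, r i j = -r j i) : tupleOp B r ∈ skewOps (PiLp 2 (fun _ : ι => E)) := by
  rw [mem_skewOps_iff_inner_self] at hB ⊢
  intro v
  have hswap : ∑ i, ∑ j, r i j * ⟪v i, v j⟫_ℝ = -∑ i, ∑ j, r i j * ⟪v i, v j⟫_ℝ := by
    conv_lhs => rw [Finset.sum_comm]
    simp only [← Finset.sum_neg_distrib]
    refine Finset.sum_congr rfl fun i _ => Finset.sum_congr rfl fun j _ => ?_
    rw [hr j i, real_inner_comm, neg_mul]
  rw [PiLp.inner_apply]
  simp only [tupleOp_apply, inner_sub_right, hB, inner_sum, real_inner_smul_right, zero_sub,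
    Finset.sum_neg_distrib]
  linarith

end TupleOperator

section Cocycle

open AffineField

variable {E : Type*} [NormedAddCommGroup E] [InnerProductSpace ℝ E] [FiniteDimensional ℝ E]

theorem exists_map_sub_apply_eq_zero {V F : Type*} [AddCommGroup V] [Module ℝ V]
    [FiniteDimensional ℝ V] [NormedAddCommGroup F] [InnerProductSpace ℝ F] [CompleteSpace F]
    (D : V →ₗ[ℝ] F) (U : Submodule ℝ V) (b : F) :
    ∃ q ∈ U, ∀ T ∈ skewOps F, ∀ B : V →ₗ[ℝ] V, ∀ c ∈ U, (∀ u ∈ U, B u ∈ U) →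
      (∀ x, T (D x) = D (B x)) → T b = D c → D (c - B q) = 0 := by
  -- `D q` is the point of `D U` closest to `b`.
  obtain ⟨q, hq, hqb⟩ := (U.map D).starProjection_apply_mem b
  have horth : b - D q ∈ (U.map D)ᗮ := hqb ▸ Submodule.sub_starProjection_mem_orthogonal b
  refine ⟨q, hq, fun T hT B c hc hBU hTD hTb => ?_⟩
  refine Submodule.disjoint_def.1 (U.map D).orthogonal_disjoint _
    (Submodule.mem_map_of_mem (U.sub_mem hc (hBU q hq))) ?_
  rw [map_sub, ← hTb, ← hTD, ← map_sub]
  refine apply_mem_orthogonal_of_mem_confOps (Submodule.mem_sup_right hT) ?_ horth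
  rintro _ ⟨u, hu, rfl⟩
  exact hTD u ▸ Submodule.mem_map_of_mem (hBU u hu)

theorem exists_apply_sub_apply_eq_zero {𝔨 : Submodule ℝ (AffineField E)} {U : Submodule ℝ E}
    (hbr : ∀ X ∈ 𝔨, ∀ Y ∈ 𝔨, bracket X Y ∈ 𝔨) (hskew : ∀ X ∈ 𝔨, X.1 ∈ skewOps E)
    (hinj : ∀ X ∈ 𝔨, X.1 = 0 → X = 0) (hU : ∀ X ∈ 𝔨, ∀ u ∈ U, X.1 u ∈ U)
    (hsnd : ∀ X ∈ 𝔨, X.2 ∈ U) :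
    ∃ q ∈ U, ∀ X ∈ 𝔨, ∀ Y ∈ 𝔨, X.1 (Y.2 - Y.1 q) = 0 := by
  have hτ : Function.Injective (hsFamily E ∘ₗ LinearMap.fst ℝ _ _ ∘ₗ 𝔨.subtype) := by
    refine (injective_iff_map_eq_zero _).2 fun X hX => Subtype.ext (hinj X X.2 ?_)
    exact hsFamily_injective (hX.trans (map_zero (hsFamily E)).symm)
  obtain ⟨m, Z, hZ⟩ := exists_eq_sum_inner_smul hτ
  -- The cocycle `X ↦ X.2` and the coboundaries `X ↦ X.1 x`, as tuples of values on `Z`.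
  let b : PiLp 2 (fun _ : Fin m => E) := WithLp.toLp 2 fun i => (Z i).1.2
  let D : E →ₗ[ℝ] PiLp 2 (fun _ : Fin m => E) :=
    { toFun x := WithLp.toLp 2 fun i => (Z i).1.1 x
      map_add' _ _ := by ext i; simp
      map_smul' _ _ := by ext i; simp }
  obtain ⟨q, hq, hqD⟩ := exists_map_sub_apply_eq_zero D U b
  refine ⟨q, hq, fun X hX Y hY => ?_⟩
  let r (i j : Fin m) : ℝ := ⟪hsFamily E (Z j).1.1, hsFamily E (bracket Y (Z i)).1⟫_ℝ
  have hr i : bracket Y (Z i) = ∑ j, r i j • (Z j).1 := by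
    simpa using congrArg Subtype.val (hZ ⟨_, hbr Y hY _ (Z i).2⟩)
  have hr₁ i (x : E) : Y.1 ((Z i).1.1 x) - (Z i).1.1 (Y.1 x) = ∑ j, r i j • (Z j).1.1 x :=
    (congrArg (fun p : AffineField E => p.1 x) (hr i)).trans (by simp [Prod.fst_sum])
  have hr₂ i : Y.1 (Z i).1.2 - (Z i).1.1 Y.2 = ∑ j, r i j • (Z j).1.2 :=
    (congrArg Prod.snd (hr i)).trans (by simp [Prod.snd_sum])
  have hT : tupleOp Y.1 r ∈ skewOps _ := tupleOp_mem_skewOps (hskew Y hY) fun i j =>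
    (real_inner_comm _ _).trans
      (inner_hsFamily_commutator (Submodule.mem_sup_right (hskew Y hY)) _ _)
  have hTb : tupleOp Y.1 r b = D Y.2 := PiLp.ext fun i =>
    sub_eq_of_eq_add (sub_eq_iff_eq_add'.1 (hr₂ i))
  have hzero : D (Y.2 - Y.1 q) = 0 := hqD _ hT Y.1 Y.2 (hsnd Y hY) (hU Y hY)
    (fun x => PiLp.ext fun i => sub_eq_of_eq_add (sub_eq_iff_eq_add'.1 (hr₁ i x))) hTb
  have hsum := congrArg (fun p : 𝔨 => p.1.1 (Y.2 - Y.1 q)) (hZ ⟨X, hX⟩)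
  have hzero' i : (Z i).1.1 (Y.2 - Y.1 q) = 0 := congrArg (fun v => v i) hzero
  simpa [Prod.fst_sum, hzero', -map_sub] using hsum

end Cocycle

/-! ### Transitive Lie algebras of similarities -/

section ConformalOperators

variable {E : Type*} [NormedAddCommGroup E] [InnerProductSpace ℝ E] [CompleteSpace E]

theorem exists_one_add_mem {𝔲 : Submodule ℝ (E →L[ℝ] E)} (h𝔲 : 𝔲 ≤ confOps E)
    (hskew : ¬𝔲 ≤ skewOps E) : ∃ A ∈ skewOps E, 1 + A ∈ 𝔲 := by
  obtain ⟨B, hB, hBs⟩ := SetLike.not_le_iff_exists.1 hskew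
  obtain ⟨s, hs⟩ := mem_confOps_iff.1 (h𝔲 hB)
  have hs₀ : s ≠ 0 := fun h => hBs (by simpa [h] using hs)
  refine ⟨s⁻¹ • (B - s • 1), (skewOps E).smul_mem _ hs, ?_⟩
  rw [smul_sub, inv_smul_smul₀ hs₀, add_sub_cancel]
  exact 𝔲.smul_mem _ hB

theorem span_one_add_sup_inf_skewOps {𝔩 : Submodule ℝ (E →L[ℝ] E)} (h𝔩 : 𝔩 ≤ confOps E)
    {A : E →L[ℝ] E} (hA : A ∈ skewOps E) (hA𝔩 : 1 + A ∈ 𝔩) :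
    ℝ ∙ (1 + A) ⊔ 𝔩 ⊓ skewOps E = 𝔩 := by
  refine le_antisymm (sup_le ((Submodule.span_singleton_le_iff_mem _ _).2 hA𝔩) inf_le_left)
    fun B hB => ?_
  obtain ⟨t, ht⟩ := mem_confOps_iff.1 (h𝔩 hB)
  refine Submodule.mem_sup.2 ⟨t • (1 + A), Submodule.mem_span_singleton.2 ⟨t, rfl⟩,
    B - t • (1 + A), ⟨𝔩.sub_mem hB (𝔩.smul_mem t hA𝔩), ?_⟩, add_sub_cancel _ _⟩
  rw [smul_add, ← sub_sub]
  exact (skewOps E).sub_mem ht ((skewOps E).smul_mem t hA)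

end ConformalOperators

namespace AffineField

section TranslationSpace

variable {E : Type*} [NormedAddCommGroup E] [NormedSpace ℝ E]

/-- The space of the vectors whose constant fields belong to `𝔰`. -/
def translationSpace (𝔰 : Submodule ℝ (AffineField E)) : Submodule ℝ E :=
  𝔰.comap (LinearMap.inr ℝ (E →L[ℝ] E) E)

variable {𝔰 : Submodule ℝ (AffineField E)}

theorem mem_translationSpace {v : E} : v ∈ translationSpace 𝔰 ↔ (0, v) ∈ 𝔰 :=
  Iff.rfl

theorem mk_mem_of_sub_mem_translationSpace {p : AffineField E} (hp : p ∈ 𝔰) {v : E}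
    (hv : v - p.2 ∈ translationSpace 𝔰) : (p.1, v) ∈ 𝔰 := by
  simpa [Prod.add_def] using 𝔰.add_mem hp hv

theorem map_fst_prod_top (h : translationSpace 𝔰 = ⊤) :
    (𝔰.map (LinearMap.fst ℝ (E →L[ℝ] E) E)).prod ⊤ = 𝔰 := by
  refine le_antisymm ?_ fun p hp => ⟨Submodule.mem_map_of_mem hp, trivial⟩
  rintro ⟨_, v⟩ ⟨⟨p, hp, rfl⟩, -⟩
  exact mk_mem_of_sub_mem_translationSpace hp (h ▸ Submodule.mem_top)

end TranslationSpace

namespace IsSimAlgebra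

variable {E : Type*} [NormedAddCommGroup E] [InnerProductSpace ℝ E]
  {𝔰 : Submodule ℝ (AffineField E)}

section Complete

variable [CompleteSpace E]

theorem apply_mem_translationSpace (h𝔰 : IsSimAlgebra 𝔰) {p : AffineField E} (hp : p ∈ 𝔰) {v : E}
    (hv : v ∈ translationSpace 𝔰) : p.1 v ∈ translationSpace 𝔰 := by
  simpa [bracket, mem_translationSpace] using h𝔰.bracket_mem p hp _ hv

theorem apply_mem_orthogonal (h𝔰 : IsSimAlgebra 𝔰) {p : AffineField E} (hp : p ∈ 𝔰) {v : E}
    (hv : v ∈ (translationSpace 𝔰)ᗮ) : p.1 v ∈ (translationSpace 𝔰)ᗮ :=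
  apply_mem_orthogonal_of_mem_confOps (h𝔰.fst_mem_confOps p hp)
    (fun _ => h𝔰.apply_mem_translationSpace hp) hv

theorem commutator_mem_map_fst (h𝔰 : IsSimAlgebra 𝔰) :
    ∀ B ∈ 𝔰.map (LinearMap.fst ℝ _ _), ∀ C ∈ 𝔰.map (LinearMap.fst ℝ _ _),
      B * C - C * B ∈ 𝔰.map (LinearMap.fst ℝ _ _) := by
  rintro _ ⟨p, hp, rfl⟩ _ ⟨q, hq, rfl⟩
  exact Submodule.mem_map_of_mem (h𝔰.bracket_mem p hp q hq)

theorem map_fst_le_confOps (h𝔰 : IsSimAlgebra 𝔰) : 𝔰.map (LinearMap.fst ℝ _ _) ≤ confOps E :=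
  Submodule.map_le_iff_le_comap.2 h𝔰.fst_mem_confOps

end Complete

variable [FiniteDimensional ℝ E]

theorem translationSpace_eq_top (h𝔰 : IsSimAlgebra 𝔰) (hirr : IsAffineIrreducible 𝔰)
    {q : AffineField E} (hq : q ∈ 𝔰) (hinj : Function.Injective q.1)
    (hcomm : ∀ p ∈ 𝔰, Commute q.1 p.1) : translationSpace 𝔰 = ⊤ := by
  obtain ⟨x, hx⟩ := LinearMap.injective_iff_surjective (f := (q.1 : E →ₗ[ℝ] E)).1 hinj q.2
  refine hirr _ (-x) (fun p hp v => h𝔰.apply_mem_translationSpace hp) fun p hp => ?_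
  have hmem : q.1 (p.2 - p.1 x) ∈ translationSpace 𝔰 := by
    have hbr := h𝔰.bracket_mem q hq p hp
    have hqp : q.1 (p.1 x) = p.1 q.2 := hx ▸ congrArg (fun T : E →L[ℝ] E => T x) (hcomm p hp)
    rwa [bracket, sub_eq_zero.2 (hcomm p hp).eq, ← hqp, ← map_sub] at hbr
  have hsurj := (LinearMap.injective_iff_surjective (f := (q.1 : E →ₗ[ℝ] E).restrict
    fun v => h𝔰.apply_mem_translationSpace hq)).1 fun v w hvw =>
      Subtype.ext (hinj (congrArg Subtype.val hvw))
  obtain ⟨w, hw⟩ := hsurj ⟨_, hmem⟩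
  rw [map_neg, neg_add_eq_sub, ← hinj (congrArg Subtype.val hw)]
  exact w.2

theorem exists_eq_prod_top (h𝔰 : IsSimAlgebra 𝔰) (hirr : IsAffineIrreducible 𝔰)
    (hsim : ¬∀ p ∈ 𝔰, p.1 ∈ skewOps E) :
    ∃ A ∈ skewOps E, ∃ 𝔥 ≤ skewOps E, (∀ B ∈ 𝔥, ∀ C ∈ 𝔥, B * C - C * B ∈ 𝔥) ∧
      (∀ B ∈ 𝔥, Commute A B) ∧ 𝔰 = (ℝ ∙ (1 + A) ⊔ 𝔥).prod ⊤ := by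
  set 𝔩 := 𝔰.map (LinearMap.fst ℝ (E →L[ℝ] E) E)
  have hconf : 𝔩 ≤ confOps E := h𝔰.map_fst_le_confOps
  have hbr : ∀ B ∈ 𝔩, ∀ C ∈ 𝔩, B * C - C * B ∈ 𝔩 ⊓ skewOps E := fun B hB C hC =>
    ⟨h𝔰.commutator_mem_map_fst B hB C hC, mul_sub_mul_mem_skewOps (hconf hB) (hconf hC)⟩
  obtain ⟨𝔲, -, h𝔲, hcomm⟩ := exists_central_complement hconf inf_le_left hbr
  have h𝔲𝔩 : 𝔲 ≤ 𝔩 := h𝔲 ▸ le_sup_left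
  have h𝔲skew : ¬𝔲 ≤ skewOps E := fun h => hsim fun p hp =>
    (sup_le h inf_le_right : 𝔲 ⊔ 𝔩 ⊓ skewOps E ≤ skewOps E) (h𝔲.ge (Submodule.mem_map_of_mem hp))
  obtain ⟨A, hA, hA𝔲⟩ := exists_one_add_mem (h𝔲𝔩.trans hconf) h𝔲skew
  obtain ⟨q, hq, hqA : q.1 = 1 + A⟩ := h𝔲𝔩 hA𝔲
  have htop : translationSpace 𝔰 = ⊤ := h𝔰.translationSpace_eq_top hirr hq
    (hqA ▸ injective_one_add hA)
    fun p hp => hqA ▸ (hcomm p.1 (Submodule.mem_map_of_mem hp) _ hA𝔲).symm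
  refine ⟨A, hA, 𝔩 ⊓ skewOps E, inf_le_right, fun B hB C hC => hbr B hB.1 C hC.1,
    fun B hB => ?_, ?_⟩
  · simpa using (hcomm B hB.1 _ hA𝔲).symm.sub_left (Commute.one_left B)
  · rw [span_one_add_sup_inf_skewOps hconf hA (h𝔲𝔩 hA𝔲), map_fst_prod_top htop]

end IsSimAlgebra

end AffineField

/-! ### Transitive Lie algebras of isometries -/

theorem exists_range_prod_subtype_eq {V E : Type*} [AddCommGroup V] [Module ℝ V] [AddCommGroup E]
    [Module ℝ E] {𝔪 : Submodule ℝ (V × E)} (h𝔪 : ∀ p ∈ 𝔪, p.2 = 0 → p = 0) {U : Submodule ℝ E}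
    (hU : 𝔪.map (LinearMap.snd ℝ V E) = U) :
    ∃ Γ : U →ₗ[ℝ] V, LinearMap.range (Γ.prod U.subtype) = 𝔪 := by
  have hmem (p : 𝔪) : p.1.2 ∈ U := hU ▸ Submodule.mem_map_of_mem p.2
  let e : 𝔪 ≃ₗ[ℝ] U := LinearEquiv.ofBijective
    ((LinearMap.snd ℝ V E ∘ₗ 𝔪.subtype).codRestrict U hmem)
    ⟨(injective_iff_map_eq_zero _).2 fun p hp => Subtype.ext (h𝔪 p p.2 (congrArg Subtype.val hp)),
      fun u => by
        obtain ⟨p, hp, hpu⟩ := hU.ge u.2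
        exact ⟨⟨p, hp⟩, Subtype.ext hpu⟩⟩
  have he (u : U) : ((e.symm u : V × E).1, (u : E)) = e.symm u :=
    Prod.ext rfl (congrArg Subtype.val (e.apply_symm_apply u)).symm
  refine ⟨LinearMap.fst ℝ V E ∘ₗ 𝔪.subtype ∘ₗ e.symm, le_antisymm ?_ fun p hp => ⟨e ⟨p, hp⟩, ?_⟩⟩
  · rintro _ ⟨u, rfl⟩
    exact (congrArg (· ∈ 𝔪) (he u)).mpr (e.symm u).2
  · exact (he _).trans (congrArg Subtype.val (e.symm_apply_apply _))

namespace AffineField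

section Transport

variable {E : Type*} [NormedAddCommGroup E] [NormedSpace ℝ E]

theorem bracket_transport (q : E) (p r : AffineField E) :
    bracket (transport q p) (transport q r) = transport q (bracket p r) := by
  simp only [bracket, transport_apply, map_sub, sub_apply]
  refine Prod.ext rfl ?_
  change _ = _ - (p.1 (r.1 q) - r.1 (p.1 q))
  abel_nf

theorem map_transport_bot_prod (q : E) (W : Submodule ℝ E) :
    ((⊥ : Submodule ℝ (E →L[ℝ] E)).prod W).map (transport q) = (⊥ : Submodule ℝ _).prod W := by
  have hfix (w : E) : transport q (0, w) = (0, w) := by simp [transport_apply]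
  refine le_antisymm ?_ ?_
  · rintro _ ⟨⟨_, w⟩, ⟨rfl, hw⟩, rfl⟩
    rw [hfix]
    exact ⟨rfl, hw⟩
  · rintro ⟨_, w⟩ ⟨rfl, hw⟩
    exact ⟨(0, w), ⟨rfl, hw⟩, hfix w⟩

theorem IsAffineIrreducible.map_transport {𝔰 : Submodule ℝ (AffineField E)}
    (h : IsAffineIrreducible 𝔰) (q : E) : IsAffineIrreducible (𝔰.map (transport q)) := by
  refine fun V x₀ hV hx₀ => h V (x₀ - q)
    (fun p hp => hV (transport q p) (Submodule.mem_map_of_mem hp)) fun p hp => ?_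
  rw [map_sub, sub_add_eq_add_sub, add_sub_assoc]
  exact hx₀ (transport q p) (Submodule.mem_map_of_mem hp)

end Transport

variable {E : Type*} [NormedAddCommGroup E] [InnerProductSpace ℝ E]

/-- The fields `x ↦ Γ u x + u`. They generate the group of screw isometries with `Ψ = exp ∘ Γ`. -/
noncomputable def screwFields {W : Submodule ℝ E} (Γ : Wᗮ →ₗ[ℝ] E →L[ℝ] E) :
    Submodule ℝ (AffineField E) :=
  LinearMap.range (Γ.prod Wᗮ.subtype)

/-- The infinitesimal version of the data `W`, `H`, `Ψ` of a group `(H × U^Ψ) ⋉ W`, where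
`U = Wᗮ`: the Lie algebra `𝔥` of `H` and the differential `Γ` of `Ψ`. -/
structure IsScrewDatum [CompleteSpace E] (W : Submodule ℝ E) (𝔥 : Submodule ℝ (E →L[ℝ] E))
    (Γ : Wᗮ →ₗ[ℝ] E →L[ℝ] E) : Prop where
  le_skewOps : 𝔥 ≤ skewOps E
  commutator_mem : ∀ A ∈ 𝔥, ∀ B ∈ 𝔥, A * B - B * A ∈ 𝔥
  apply_eq_zero : ∀ A ∈ 𝔥, ∀ u ∈ Wᗮ, A u = 0
  mem_skewOps : ∀ u, Γ u ∈ skewOps E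
  map_apply_eq_zero : ∀ u, ∀ v ∈ Wᗮ, Γ u v = 0
  map_commute_map : ∀ u v, Commute (Γ u) (Γ v)
  commute_map : ∀ A ∈ 𝔥, ∀ u, Commute A (Γ u)
  injective : Function.Injective Γ

namespace IsScrewDatum

variable [CompleteSpace E] {W : Submodule ℝ E} {𝔥 : Submodule ℝ (E →L[ℝ] E)}
  {Γ : Wᗮ →ₗ[ℝ] E →L[ℝ] E}

theorem sup_screwFields_le (h : IsScrewDatum W 𝔥 Γ) :
    𝔥.prod ⊥ ⊔ screwFields Γ ≤ (skewOps E).prod Wᗮ := by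
  refine sup_le (Submodule.prod_mono h.le_skewOps bot_le) ?_
  rintro _ ⟨u, rfl⟩
  exact ⟨h.mem_skewOps u, u.2⟩

theorem fst_apply_eq_zero (h : IsScrewDatum W 𝔥 Γ) {p : AffineField E}
    (hp : p ∈ 𝔥.prod ⊥ ⊔ screwFields Γ) {v : E} (hv : v ∈ Wᗮ) : p.1 v = 0 := by
  obtain ⟨⟨A, a⟩, ⟨hA, -⟩, _, ⟨u, rfl⟩, rfl⟩ := Submodule.mem_sup.1 hp
  change A v + Γ u v = 0
  rw [h.apply_eq_zero A hA v hv, h.map_apply_eq_zero u v hv, add_zero]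

end IsScrewDatum

theorem map_snd_eq_orthogonal {𝔨 : Submodule ℝ (AffineField E)} {W : Submodule ℝ E}
    (hirr : IsAffineIrreducible (𝔨 ⊔ (⊥ : Submodule ℝ (E →L[ℝ] E)).prod W))
    (hW : ∀ X ∈ 𝔨, ∀ w ∈ W, X.1 w ∈ W) (hzero : ∀ X ∈ 𝔨, ∀ Y ∈ 𝔨, X.1 Y.2 = 0)
    (hsnd : ∀ X ∈ 𝔨, X.2 ∈ Wᗮ) : 𝔨.map (LinearMap.snd ℝ _ _) = Wᗮ := by
  have htop : 𝔨.map (LinearMap.snd ℝ (E →L[ℝ] E) E) ⊔ W = ⊤ := by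
    refine hirr _ 0 (fun p hp v hv => ?_) fun p hp => ?_
    · obtain ⟨X, hX, ⟨_, w⟩, ⟨rfl, -⟩, rfl⟩ := Submodule.mem_sup.1 hp
      obtain ⟨_, ⟨Y, hY, rfl⟩, w', hw', rfl⟩ := Submodule.mem_sup.1 hv
      have hXY : (X + (0, w)).1 (Y.2 + w') = X.1 w' := by
        change (X.1 + 0) (Y.2 + w') = _
        rw [add_zero, map_add, hzero X hX Y hY, zero_add]
      exact Submodule.mem_sup_right (hXY ▸ hW X hX w' hw')
    · obtain ⟨X, hX, ⟨_, w⟩, ⟨rfl, hw⟩, rfl⟩ := Submodule.mem_sup.1 hp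
      rw [map_zero, zero_add]
      exact Submodule.add_mem_sup (Submodule.mem_map_of_mem hX) hw
  have hle : 𝔨.map (LinearMap.snd ℝ (E →L[ℝ] E) E) ≤ Wᗮ := Submodule.map_le_iff_le_comap.2 hsnd
  rw [← top_inf_eq Wᗮ, ← htop, sup_inf_assoc_of_le W hle, W.inf_orthogonal_eq_bot, sup_bot_eq]

/-- The fields in `𝔰` whose value at the origin is orthogonal to the translations in `𝔰`. They
complement the translations in `𝔰`. -/
noncomputable def orthogonalFields (𝔰 : Submodule ℝ (AffineField E)) :
    Submodule ℝ (AffineField E) :=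
  𝔰 ⊓ (⊤ : Submodule ℝ (E →L[ℝ] E)).prod (translationSpace 𝔰)ᗮ

theorem eq_zero_of_mem_orthogonalFields {𝔰 : Submodule ℝ (AffineField E)} {X : AffineField E}
    (hX : X ∈ orthogonalFields 𝔰) (hX₁ : X.1 = 0) : X = 0 :=
  Prod.ext hX₁ <| Submodule.disjoint_def.1 (translationSpace 𝔰).orthogonal_disjoint _
    (hX₁ ▸ hX.1 : ((0 : E →L[ℝ] E), X.2) ∈ 𝔰) hX.2.2

theorem IsSimAlgebra.bracket_mem_orthogonalFields [CompleteSpace E]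
    {𝔰 : Submodule ℝ (AffineField E)} (h𝔰 : IsSimAlgebra 𝔰)
    {X Y : AffineField E} (hX : X ∈ orthogonalFields 𝔰)
    (hY : Y ∈ orthogonalFields 𝔰) : bracket X Y ∈ orthogonalFields 𝔰 :=
  ⟨h𝔰.bracket_mem X hX.1 Y hY.1, trivial,
    Submodule.sub_mem _ (h𝔰.apply_mem_orthogonal hX.1 hY.2.2)
      (h𝔰.apply_mem_orthogonal hY.1 hX.2.2)⟩

variable [FiniteDimensional ℝ E]

theorem exists_central_complement_prod_bot {𝔨 : Submodule ℝ (AffineField E)}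
    (hbr : ∀ X ∈ 𝔨, ∀ Y ∈ 𝔨, bracket X Y ∈ 𝔨) (hskew : ∀ X ∈ 𝔨, X.1 ∈ skewOps E)
    (hzero : ∀ X ∈ 𝔨, ∀ Y ∈ 𝔨, X.1 Y.2 = 0) :
    ∃ 𝔪 ≤ 𝔨, (𝔨.comap (LinearMap.inl ℝ _ _)).prod ⊥ ⊔ 𝔪 = 𝔨 ∧
      (∀ Y ∈ 𝔪, Y.2 = 0 → Y = 0) ∧ ∀ X ∈ 𝔨, ∀ Y ∈ 𝔪, Commute X.1 Y.1 := by
  set 𝔥 := 𝔨.comap (LinearMap.inl ℝ (E →L[ℝ] E) E)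
  have hconf : 𝔨.map (LinearMap.fst ℝ (E →L[ℝ] E) E) ≤ confOps E :=
    Submodule.map_le_iff_le_comap.2 fun X hX => Submodule.mem_sup_right (hskew X hX)
  obtain ⟨𝔲, hdisj, hsup, hcomm⟩ := exists_central_complement (𝔥 := 𝔥) hconf
    (fun A hA => ⟨(A, 0), hA, rfl⟩) (by
      rintro _ ⟨X, hX, rfl⟩ _ ⟨Y, hY, rfl⟩
      have h := hbr X hX Y hY
      rwa [bracket, hzero X hX Y hY, hzero Y hY X hX, sub_zero] at h)
  refine ⟨𝔨 ⊓ 𝔲.prod ⊤, inf_le_left, le_antisymm (sup_le ?_ inf_le_left) fun X hX => ?_,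
    fun Y hY hY₂ => Prod.ext ?_ hY₂,
    fun X hX Y hY => hcomm _ (Submodule.mem_map_of_mem hX) _ hY.2.1⟩
  · rintro ⟨A, _⟩ ⟨hA, rfl⟩
    exact hA
  · obtain ⟨C, hC, A, hA, hCA : C + A = X.1⟩ :=
      Submodule.mem_sup.1 (hsup.ge (Submodule.mem_map_of_mem hX))
    have hAX : (A, 0) + (C, X.2) = X := Prod.ext ((add_comm A C).trans hCA) (zero_add _)
    have hCX : (C, X.2) ∈ 𝔨 := (Submodule.add_mem_iff_right 𝔨 hA).1 (hAX.symm ▸ hX)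
    exact Submodule.mem_sup.2 ⟨(A, 0), ⟨hA, rfl⟩, (C, X.2), ⟨hCX, hC, trivial⟩, hAX⟩
  · exact Submodule.disjoint_def.1 hdisj _ hY.2.1 (hY₂ ▸ hY.1 : (Y.1, (0 : E)) ∈ 𝔨)

theorem exists_isScrewDatum {𝔨 : Submodule ℝ (AffineField E)} {W : Submodule ℝ E}
    (hbr : ∀ X ∈ 𝔨, ∀ Y ∈ 𝔨, bracket X Y ∈ 𝔨) (hskew : ∀ X ∈ 𝔨, X.1 ∈ skewOps E)
    (hinj : ∀ X ∈ 𝔨, X.1 = 0 → X = 0) (hzero : ∀ X ∈ 𝔨, ∀ Y ∈ 𝔨, X.1 Y.2 = 0)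
    (hsnd : 𝔨.map (LinearMap.snd ℝ _ _) = Wᗮ) :
    ∃ (𝔥 : Submodule ℝ (E →L[ℝ] E)) (Γ : Wᗮ →ₗ[ℝ] E →L[ℝ] E),
      IsScrewDatum W 𝔥 Γ ∧ 𝔥.prod ⊥ ⊔ screwFields Γ = 𝔨 := by
  obtain ⟨𝔪, h𝔪, hsup, h𝔪₂, hcomm⟩ := exists_central_complement_prod_bot hbr hskew hzero
  have h𝔪snd : 𝔪.map (LinearMap.snd ℝ _ _) = Wᗮ := by
    rw [← hsnd, ← hsup, Submodule.map_sup, Submodule.prod_map_snd, bot_sup_eq]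
  obtain ⟨Γ, hΓ⟩ := exists_range_prod_subtype_eq h𝔪₂ h𝔪snd
  have hkill : ∀ X ∈ 𝔨, ∀ u ∈ Wᗮ, X.1 u = 0 := by
    intro X hX u hu
    obtain ⟨Y, hY, rfl⟩ := hsnd.ge hu
    exact hzero X hX Y hY
  have hΓ𝔪 (u : Wᗮ) : (Γ u, (u : E)) ∈ 𝔪 := hΓ.le ⟨u, rfl⟩
  have hΓ𝔨 (u : Wᗮ) : (Γ u, (u : E)) ∈ 𝔨 := h𝔪 (hΓ𝔪 u)
  refine ⟨𝔨.comap (LinearMap.inl ℝ _ _), Γ, ?_, by rw [screwFields, hΓ, hsup]⟩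
  exact
    { le_skewOps := fun A hA => hskew (A, 0) hA
      commutator_mem := fun A hA B hB => by simpa [bracket] using hbr (A, 0) hA (B, 0) hB
      apply_eq_zero := fun A hA => hkill (A, 0) hA
      mem_skewOps := fun u => hskew (Γ u, u) (hΓ𝔨 u)
      map_apply_eq_zero := fun u => hkill (Γ u, u) (hΓ𝔨 u)
      map_commute_map := fun u v => hcomm (Γ u, u) (hΓ𝔨 u) (Γ v, v) (hΓ𝔪 v)
      commute_map := fun A hA u => hcomm (A, 0) hA (Γ u, u) (hΓ𝔪 u)
      injective := (injective_iff_map_eq_zero Γ).2 fun u hu =>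
        Subtype.ext (congrArg Prod.snd (hinj (Γ u, u) (hΓ𝔨 u) hu)) }

theorem orthogonalFields_sup (𝔰 : Submodule ℝ (AffineField E)) :
    orthogonalFields 𝔰 ⊔ (⊥ : Submodule ℝ (E →L[ℝ] E)).prod (translationSpace 𝔰) = 𝔰 := by
  refine le_antisymm (sup_le inf_le_left ?_) fun p hp => ?_
  · rintro ⟨_, w⟩ ⟨rfl, hw⟩
    exact hw
  · have hw := (translationSpace 𝔰).starProjection_apply_mem p.2
    have hu := (translationSpace 𝔰).sub_starProjection_mem_orthogonal p.2
    refine Submodule.mem_sup.2 ⟨(p.1, _), ⟨mk_mem_of_sub_mem_translationSpace hp ?_, trivial, hu⟩,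
      (0, _), ⟨rfl, hw⟩, Prod.ext (add_zero _) (sub_add_cancel _ _)⟩
    simp [hw]

theorem IsSimAlgebra.exists_isScrewDatum_map_transport {𝔰 : Submodule ℝ (AffineField E)}
    (h𝔰 : IsSimAlgebra 𝔰) (hirr : IsAffineIrreducible 𝔰) (hskew : ∀ p ∈ 𝔰, p.1 ∈ skewOps E) :
    ∃ (q : E) (W : Submodule ℝ E) (𝔥 : Submodule ℝ (E →L[ℝ] E)) (Γ : Wᗮ →ₗ[ℝ] E →L[ℝ] E),
      IsScrewDatum W 𝔥 Γ ∧
        𝔰.map (transport q) = (𝔥.prod ⊥ ⊔ screwFields Γ) ⊔ (⊥ : Submodule ℝ _).prod W := by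
  set W := translationSpace 𝔰
  obtain ⟨q, hq, hqzero⟩ := exists_apply_sub_apply_eq_zero
    (fun X hX Y hY => h𝔰.bracket_mem_orthogonalFields hX hY) (fun X hX => hskew X hX.1)
    (fun X => eq_zero_of_mem_orthogonalFields)
    (fun X hX _ => h𝔰.apply_mem_orthogonal hX.1) fun X hX => hX.2.2
  set 𝔨 := (orthogonalFields 𝔰).map (transport q)
  have hsup : 𝔰.map (transport q) = 𝔨 ⊔ (⊥ : Submodule ℝ (E →L[ℝ] E)).prod W := by
    nth_rw 1 [← orthogonalFields_sup 𝔰]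
    rw [Submodule.map_sup, map_transport_bot_prod]
  have hbr : ∀ X ∈ 𝔨, ∀ Y ∈ 𝔨, bracket X Y ∈ 𝔨 := by
    rintro _ ⟨X, hX, rfl⟩ _ ⟨Y, hY, rfl⟩
    exact bracket_transport q X Y ▸
      Submodule.mem_map_of_mem (h𝔰.bracket_mem_orthogonalFields hX hY)
  have hinj : ∀ X ∈ 𝔨, X.1 = 0 → X = 0 := by
    rintro _ ⟨X, hX, rfl⟩ hX₁
    rw [eq_zero_of_mem_orthogonalFields hX hX₁, map_zero]
  have hzero : ∀ X ∈ 𝔨, ∀ Y ∈ 𝔨, X.1 Y.2 = 0 := by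
    rintro _ ⟨X, hX, rfl⟩ _ ⟨Y, hY, rfl⟩
    exact hqzero X hX Y hY
  have hsnd : 𝔨.map (LinearMap.snd ℝ _ _) = Wᗮ := by
    refine map_snd_eq_orthogonal (hsup ▸ hirr.map_transport q) ?_ hzero ?_
    · rintro _ ⟨X, hX, rfl⟩ w
      exact h𝔰.apply_mem_translationSpace hX.1
    · rintro _ ⟨X, hX, rfl⟩
      exact Wᗮ.sub_mem hX.2.2 (h𝔰.apply_mem_orthogonal hX.1 hq)
  have hskew𝔨 : ∀ X ∈ 𝔨, X.1 ∈ skewOps E := by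
    rintro _ ⟨X, hX, rfl⟩
    exact hskew X hX.1
  obtain ⟨𝔥, Γ, hΓ, h𝔥Γ⟩ := exists_isScrewDatum hbr hskew𝔨 hinj hzero hsnd
  exact ⟨q, W, 𝔥, Γ, hΓ, by rw [hsup, h𝔥Γ]⟩

end AffineField

/-! ### Groups of the four types -/

section Products

open AffineField

variable {n : ℕ}

theorem isDirectProd_affExpSubgroup {𝔭 𝔮 : Submodule ℝ (AffineField (Euc n))}
    (hbracket : ∀ p ∈ 𝔭, ∀ q ∈ 𝔮, bracket p q = 0)
    (hdisj : Disjoint (affExpSubgroup 𝔭) (affExpSubgroup 𝔮)) :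
    IsDirectProd (affExpSubgroup 𝔭) (affExpSubgroup 𝔮) (affExpSubgroup (𝔭 ⊔ 𝔮)) := by
  have h := isDirectProd_expSubgroup (affRep_injective n) (𝔤 := 𝔭.map (toEnd (Euc n)))
    (𝔥 := 𝔮.map (toEnd (Euc n))) ?_ ?_ hdisj
  · rwa [← Submodule.map_sup] at h
  · rintro _ ⟨p, hp, rfl⟩ _ ⟨q, hq, rfl⟩
    exact sub_eq_zero.1 (by rw [← toEnd_bracket, hbracket p hp q hq, map_zero])
  · rintro _ ⟨p, -, rfl⟩
    exact exists_affRep_eq_exp p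

theorem disjoint_screwHomotheties_map_rotHom (Φ : PosReal →* SOGroup n)
    (H : Subgroup (OrthGroup n)) : Disjoint (screwHomotheties Φ) (H.map (rotHom n)) := by
  rw [Subgroup.disjoint_def]
  rintro g ⟨a, hg⟩ ⟨f, -, rfl⟩
  refine AffineEquiv.ext fun x => ?_
  change f x = x
  obtain rfl | hx := eq_or_ne x 0
  · exact map_zero f
  have hfx : f x = (a : ℝ) • (Φ a : OrthGroup n) x := hg x
  have hnorm : ‖x‖ = a * ‖x‖ := by
    simpa [norm_smul, abs_of_pos a.2] using congrArg norm hfx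
  have ha : a = 1 := Subtype.ext ((right_eq_mul₀ (norm_ne_zero_iff.2 hx)).1 hnorm)
  rw [hfx, ha, map_one]
  exact one_smul ℝ x

theorem disjoint_map_rotHom_screwIsometries (H : Subgroup (OrthGroup n))
    (W : Submodule ℝ (Euc n)) (Ψ : Multiplicative Wᗮ →* SOSub W) :
    Disjoint (H.map (rotHom n)) (screwIsometries W Ψ) := by
  rw [Subgroup.disjoint_def]
  rintro _ ⟨f, -, rfl⟩ ⟨u, hu⟩
  have hu0 : u = 0 := by
    have h : f 0 = (Ψ (Multiplicative.ofAdd u) : OrthGroup n) 0 + (u : Euc n) := hu 0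
    simpa using h.symm
  refine AffineEquiv.ext fun x => (hu x).trans ?_
  simp [hu0]

end Products

section Homotheties

variable {n : ℕ}

/-- The homomorphism `a ↦ exp (log a • A)` from `ℝ⁺` to `SO(n)`, for a skew operator `A`. -/
noncomputable def rotationFlow (A : Euc n →L[ℝ] Euc n) (hA : A ∈ skewOps (Euc n)) :
    PosReal →* SOGroup n where
  toFun a := ⟨expOrth (Real.log a • A) (Submodule.smul_mem _ _ hA), expOrth_mem_SOGroup _⟩
  map_one' := Subtype.ext <| LinearIsometryEquiv.ext fun x =>
    exp_apply_of_apply_eq_zero <| by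
      change Real.log 1 • A x = 0
      rw [Real.log_one, zero_smul]
  map_mul' a b := by
    refine Subtype.ext (linRep_injective n ?_)
    change exp (Real.log (a * b : ℝ) • A) = exp (Real.log a • A) * exp (Real.log b • A)
    rw [Real.log_mul a.2.ne' b.2.ne']
    exact exp_add_smul _ _ A

theorem continuous_linRep_rotationFlow {A : Euc n →L[ℝ] Euc n} (hA : A ∈ skewOps (Euc n)) :
    Continuous fun a => linRep n (rotationFlow A hA a) := by
  have hlog : Continuous fun a : PosReal => Real.log a :=
    continuous_subtype_val.log fun a => a.2.ne'
  exact continuous_exp_real.comp (hlog.smul continuous_const)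

theorem screwHomotheties_rotationFlow {A : Euc n →L[ℝ] Euc n} (hA : A ∈ skewOps (Euc n)) :
    screwHomotheties (rotationFlow A hA) =
      affExpSubgroup ((ℝ ∙ (1 + A)).prod (⊥ : Submodule ℝ (Euc n))) := by
  have hiff (g : AffGroup n) (t : ℝ) :
      affRep n g = exp (AffineField.toEnd (Euc n) (t • (1 + A), 0)) ↔
        ∀ x, g x = Real.exp t • (exp (t • A) : Euc n →L[ℝ] Euc n) x := by
    rw [affRep_eq_exp_iff (map_zero _), exp_smul_one_add]
    simp only [add_zero, smul_apply]
  rw [affExpSubgroup_eq_closure]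
  refine le_antisymm ?_ ((Subgroup.closure_le _).2 ?_)
  · rintro g ⟨a, hg⟩
    refine Subgroup.subset_closure ⟨(Real.log a • (1 + A), 0),
      ⟨Submodule.smul_mem _ _ (Submodule.mem_span_singleton_self _), Submodule.zero_mem _⟩,
      (hiff g _).2 fun x => ?_⟩
    rw [Real.exp_log a.2]
    exact hg x
  · rintro g ⟨⟨B, b⟩, ⟨hB, hb⟩, hg⟩
    obtain ⟨t, rfl⟩ := Submodule.mem_span_singleton.1 hB
    obtain rfl : b = 0 := hb
    refine ⟨⟨Real.exp t, Real.exp_pos t⟩, fun x => ((hiff g t).1 hg x).trans ?_⟩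
    change _ = Real.exp t • (exp (Real.log (Real.exp t) • A) : Euc n →L[ℝ] Euc n) x
    rw [Real.log_exp]

theorem isType3_affExpSubgroup {A : Euc n →L[ℝ] Euc n} {𝔥 : Submodule ℝ (Euc n →L[ℝ] Euc n)}
    (hA : A ∈ skewOps (Euc n)) (h𝔥 : 𝔥 ≤ skewOps (Euc n))
    (hbr : ∀ B ∈ 𝔥, ∀ C ∈ 𝔥, B * C - C * B ∈ 𝔥) (hcomm : ∀ B ∈ 𝔥, Commute A B) :
    IsType3 (affExpSubgroup ((ℝ ∙ (1 + A) ⊔ 𝔥).prod (⊤ : Submodule ℝ (Euc n)))) := by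
  have hle : expSubgroup (linRep n) 𝔥 ≤ SOSub ⊤ :=
    expSubgroup_linRep_le_SOSub h𝔥 fun B _ x hx => by
      rw [Submodule.top_orthogonal_eq_bot] at hx
      rw [(Submodule.mem_bot ℝ).1 hx, map_zero]
  refine ⟨expSubgroup (linRep n) 𝔥, fun f hf => (hle hf).1,
    isConnectedLieSubgroup_expSubgroup_linRep h𝔥 hbr, rotationFlow A hA,
    continuous_linRep_rotationFlow hA,
    affExpSubgroup ((ℝ ∙ (1 + A) ⊔ 𝔥).prod (⊥ : Submodule ℝ (Euc n))), ?_, ?_⟩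
  · have hdisj := disjoint_screwHomotheties_map_rotHom (rotationFlow A hA)
      (expSubgroup (linRep n) 𝔥)
    rw [screwHomotheties_rotationFlow, map_rotHom_expSubgroup h𝔥] at hdisj ⊢
    rw [← sup_idem (⊥ : Submodule ℝ (Euc n)), ← Submodule.prod_sup_prod, sup_idem]
    refine isDirectProd_affExpSubgroup ?_ hdisj
    rintro ⟨B, b⟩ ⟨hB, hb⟩ ⟨C, c⟩ ⟨hC, hc⟩
    obtain ⟨t, rfl⟩ := Submodule.mem_span_singleton.1 hB
    obtain rfl : b = 0 := hb
    obtain rfl : c = 0 := hc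
    have hBC : Commute (t • (1 + A)) C := ((Commute.one_left C).add_left (hcomm C hC)).smul_left t
    exact Prod.ext (sub_eq_zero.2 hBC.eq) (by simp [AffineField.bracket])
  · have h := isSemidirectProd_affExpSubgroup
      (𝔮 := (ℝ ∙ (1 + A) ⊔ 𝔥).prod (⊥ : Submodule ℝ (Euc n))) (V := ⊤)
      (fun _ _ _ _ => Submodule.mem_top)
      (fun q _ v hv => by
        rw [Submodule.top_orthogonal_eq_bot] at hv ⊢
        exact (Submodule.mem_bot ℝ).2 (by rw [(Submodule.mem_bot ℝ).1 hv, map_zero]))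
      (fun q hq => (Submodule.mem_bot ℝ).1 hq.2 ▸ Submodule.zero_mem _)
    rwa [Submodule.prod_sup_prod, sup_bot_eq, bot_sup_eq] at h

end Homotheties

section Screws

variable {n : ℕ} {W : Submodule ℝ (Euc n)} {𝔥 : Submodule ℝ (Euc n →L[ℝ] Euc n)}
  {Γ : Wᗮ →ₗ[ℝ] Euc n →L[ℝ] Euc n}

namespace AffineField.IsScrewDatum

/-- The homomorphism `u ↦ exp (Γ u)` from `Wᗮ` to `SO(W)`. -/
noncomputable def screwHom (h : IsScrewDatum W 𝔥 Γ) : Multiplicative Wᗮ →* SOSub W :=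
  (expHom Γ.toAddMonoidHom h.mem_skewOps h.map_commute_map).codRestrict (SOSub W) fun _ =>
    expOrth_mem_SOSub (h.mem_skewOps _) (h.map_apply_eq_zero _)

theorem hasFDerivAt_screwHom (h : IsScrewDatum W 𝔥 Γ) :
    HasFDerivAt (fun u : Wᗮ => linRep n (h.screwHom (Multiplicative.ofAdd u)))
      (LinearMap.toContinuousLinearMap Γ) 0 := by
  have hexp : HasFDerivAt (𝕜 := ℝ) (exp : (Euc n →L[ℝ] Euc n) → (Euc n →L[ℝ] Euc n))
      (1 : (Euc n →L[ℝ] Euc n) →L[ℝ] (Euc n →L[ℝ] Euc n))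
      (LinearMap.toContinuousLinearMap Γ 0) := by
    rw [map_zero]
    exact hasFDerivAt_exp_zero
  exact hexp.comp 0 (LinearMap.toContinuousLinearMap Γ).hasFDerivAt

theorem screwIsometries_screwHom (h : IsScrewDatum W 𝔥 Γ) :
    screwIsometries W h.screwHom = affExpSubgroup (screwFields Γ) := by
  have hiff (g : AffGroup n) (u : Wᗮ) :
      affRep n g = exp (toEnd (Euc n) (Γ u, u)) ↔ ∀ x, g x = exp (Γ u) x + u :=
    affRep_eq_exp_iff (h.map_apply_eq_zero u u u.2)
  rw [affExpSubgroup_eq_closure]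
  refine le_antisymm ?_ ((Subgroup.closure_le _).2 ?_)
  · rintro g ⟨u, hg⟩
    exact Subgroup.subset_closure ⟨(Γ u, u), ⟨u, rfl⟩, (hiff g u).2 hg⟩
  · rintro g ⟨_, ⟨u, rfl⟩, hg⟩
    exact ⟨u, (hiff g u).1 hg⟩

theorem isType4 (h : IsScrewDatum W 𝔥 Γ) :
    IsType4 (affExpSubgroup ((𝔥.prod ⊥ ⊔ screwFields Γ) ⊔
      (⊥ : Submodule ℝ (Euc n →L[ℝ] Euc n)).prod W)) := by
  refine ⟨W, expSubgroup (linRep n) 𝔥, expSubgroup_linRep_le_SOSub h.le_skewOps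
    fun A hA x hx => h.apply_eq_zero A hA x hx,
    isConnectedLieSubgroup_expSubgroup_linRep h.le_skewOps h.commutator_mem, h.screwHom,
    continuous_exp_real.comp (LinearMap.toContinuousLinearMap Γ).continuous,
    ⟨_, h.hasFDerivAt_screwHom, h.injective⟩, affExpSubgroup (𝔥.prod ⊥ ⊔ screwFields Γ), ?_, ?_⟩
  · have hdisj := disjoint_map_rotHom_screwIsometries (expSubgroup (linRep n) 𝔥) W h.screwHom
    rw [h.screwIsometries_screwHom, map_rotHom_expSubgroup h.le_skewOps] at hdisj ⊢
    refine isDirectProd_affExpSubgroup ?_ hdisj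
    rintro ⟨A, a⟩ ⟨hA, ha⟩ _ ⟨u, rfl⟩
    obtain rfl : a = 0 := ha
    exact Prod.ext (sub_eq_zero.2 (h.commute_map A hA u).eq)
      (by simp [bracket, h.apply_eq_zero A hA u u.2])
  · refine isSemidirectProd_affExpSubgroup (fun p hp w hw => ?_)
      (fun p hp v hv => (h.fst_apply_eq_zero hp hv).symm ▸ Wᗮ.zero_mem)
      fun p hp => (h.sup_screwFields_le hp).2
    rw [← W.orthogonal_orthogonal] at hw ⊢
    exact apply_mem_orthogonal_of_mem_confOps
      (Submodule.mem_sup_right (h.sup_screwFields_le hp).1)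
      (fun v hv => (h.fst_apply_eq_zero hp hv).symm ▸ Wᗮ.zero_mem) hw

end AffineField.IsScrewDatum

end Screws

/-! ### Transitivity -/

section Transitivity

variable {n : ℕ} {K : Subgroup (AffGroup n)}

theorem IsSemidirectProd.right_le {Γ : Type*} [Group Γ] {A N K : Subgroup Γ}
    (h : IsSemidirectProd A N K) : N ≤ K :=
  le_sup_right.trans h.2.2.ge

theorem exists_mem_apply_eq_of_translations_le (h : translations ⊤ ≤ K) (x y : Euc n) :
    ∃ g ∈ K, g x = y :=
  ⟨AffineEquiv.constVAdd ℝ (Euc n) (y - x), h ⟨y - x, trivial, fun z => add_comm _ z⟩,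
    sub_add_cancel y x⟩

theorem apply_sub_mem_of_mem_SOSub {W : Submodule ℝ (Euc n)} {f : OrthGroup n} (hf : f ∈ SOSub W)
    (x : Euc n) : f x - x ∈ W := by
  rw [← W.orthogonal_orthogonal]
  intro v hv
  rw [inner_sub_right, sub_eq_zero]
  nth_rw 1 [← hf.2 v hv]
  exact f.inner_map_map v x

theorem IsType4.exists_mem_apply_eq (hK : IsType4 K) (x y : Euc n) : ∃ g ∈ K, g x = y := by
  obtain ⟨W, H, -, -, Ψ, -, -, D, ⟨-, -, rfl⟩, -, -, rfl⟩ := hK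
  let u : Wᗮ := ⟨(y - x) - W.starProjection (y - x), W.sub_starProjection_mem_orthogonal _⟩
  let f : OrthGroup n := Ψ (Multiplicative.ofAdd u)
  let k : AffGroup n := AffineEquiv.constVAdd ℝ (Euc n) (u : Euc n) * rotHom n f
  have hk (z : Euc n) : k z = f z + u := add_comm _ _
  have hW : y - k x ∈ W := by
    have hyk : y - k x = W.starProjection (y - x) - (f x - x) := by
      rw [hk]
      change y - (f x + ((y - x) - W.starProjection (y - x))) = _
      abel
    rw [hyk]
    exact W.sub_mem (W.starProjection_apply_mem _)
      (apply_sub_mem_of_mem_SOSub (Ψ (Multiplicative.ofAdd u)).2 x)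
  exact ⟨AffineEquiv.constVAdd ℝ (Euc n) (y - k x) * k,
    mul_mem (Subgroup.mem_sup_right ⟨y - k x, hW, fun z => add_comm _ z⟩)
      (Subgroup.mem_sup_left (Subgroup.mem_sup_right ⟨u, hk⟩)),
    sub_add_cancel y (k x)⟩

theorem exists_mem_apply_eq_of_map_conj {G : Subgroup (AffGroup n)} {c : AffGroup n}
    (h : ∀ x y, ∃ g ∈ G.map (MulAut.conj c).toMonoidHom, g x = y) (x y : Euc n) :
    ∃ g ∈ G, g x = y := by
  obtain ⟨_, ⟨g, hg, rfl⟩, hgx⟩ := h (c x) (c y)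
  have hcg : c (g (c.symm (c x))) = c y := hgx
  rw [c.symm_apply_apply] at hcg
  exact ⟨g, hg, c.injective hcg⟩

theorem constVAdd_mem_Sim0 (q : Euc n) : AffineEquiv.constVAdd ℝ (Euc n) q ∈ Sim0 n :=
  ⟨1, 1, one_mem _, q, fun x => (add_comm q x).trans (congrArg (· + q) (one_smul ℝ x).symm)⟩

end Transitivity

theorem theorem12 (n : ℕ) (G : Subgroup (AffGroup n)) (hG : G ≤ Sim0 n)
    (hconn : IsConnectedLieSubgroup (affRep n) G) :
    (∀ x y : Euc n, ∃ g ∈ G, g x = y) ↔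
      ∃ c ∈ Sim0 n, ∃ K : Subgroup (AffGroup n),
        K = G.map (MulAut.conj c).toMonoidHom ∧
          (IsType1 K ∨ IsType2 K ∨ IsType3 K ∨ IsType4 K) := by
  constructor
  · intro htrans
    obtain ⟨𝔰, h𝔰, rfl⟩ := exists_isSimAlgebra hG hconn
    have hirr := isAffineIrreducible_of_transitive htrans
    by_cases hskew : ∀ p ∈ 𝔰, p.1 ∈ skewOps (Euc n)
    · obtain ⟨q, W, 𝔥, Γ, hΓ, hmap⟩ := h𝔰.exists_isScrewDatum_map_transport hirr hskew
      refine ⟨_, constVAdd_mem_Sim0 q, _, rfl, Or.inr (Or.inr (Or.inr ?_))⟩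
      rw [map_conj_affExpSubgroup, hmap]
      exact hΓ.isType4
    · obtain ⟨A, hA, 𝔥, h𝔥, hbr, hcomm, rfl⟩ := h𝔰.exists_eq_prod_top hirr hskew
      exact ⟨1, one_mem _, _, by rw [map_one]; exact (Subgroup.map_id _).symm,
        Or.inr (Or.inr (Or.inl (isType3_affExpSubgroup hA h𝔥 hbr hcomm)))⟩
  · rintro ⟨c, -, _, rfl, htype⟩
    refine exists_mem_apply_eq_of_map_conj (c := c) ?_
    obtain ⟨_, -, -, _, -, hK⟩ | ⟨_, -, -, hK⟩ | ⟨_, -, -, _, -, _, -, hK⟩ | hK := htype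
    · exact exists_mem_apply_eq_of_translations_le hK.right_le
    · exact exists_mem_apply_eq_of_translations_le hK.right_le
    · exact exists_mem_apply_eq_of_translations_le hK.right_le
    · exact hK.exists_mem_apply_eq
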